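/- Let $\mathcal H$ be a nonzero finite-dimensional complex Hilbert space and let $V\in\mathcal L(\mathcal H\otimes\mathcal H)$ be a multiplicative unitary, i.e. a unitary with $V_{12}V_{13}V_{23}=V_{23}V_{12}$ on $\mathcal H\otimes\mathcal H\otimes\mathcal H$. Assume that $V$ has multiplicity $1$, i.e. the space of fixed vectors $\{\xi\in\mathcal H : V(\xi\otimes\eta)=\xi\otimes\eta \text{ for all } \eta\in\mathcal H\}$ has dimension $1$. Let $$S=\{(\omega\otimes\mathrm{id})(V) : \omega\in\mathcal L(\mathcal H)^*\},\qquad \widehat S=\{(\mathrm{id}\otimes\omega)(V) : \omega\in\mathcal L(\mathcal H)^*\}$$ be the associated Hopf algebras (subalgebras of $\mathcal L(\mathcal H)$), with coproducts $\delta(x)=V(x\otimes 1)V^*$ on $S$ and $\widehat\delta(x)=V^*(1\otimes x)V$ on $\widehat S$. A subalgebra $B$ of $S$ containing the unit (and not assumed to be stable under the involution) is called a right (resp. left) coideal subalgebra if $\delta(B)\subset B\otimes S$ (resp. $\delta(B)\subset S\otimes B$); similarly for $(\widehat S,\widehat\delta)$. Then (Lagrange's theorem) the dimension of every right or left coideal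 subalgebra of $S$ divides $\dim S$. Likewise, the dimension of every right or left coideal subalgebra of $\widehat S$ divides $\dim S$. -/

import Mathlib

open scoped TensorProduct

namespace MultUnitary

variable {H : Type*} [NormedAddCommGroup H] [InnerProductSpace ℂ H] [FiniteDimensional ℂ H]

/-- The operator `T₁₂` on `H ⊗ H ⊗ H`. -/
noncomputable def leg12 (T : Module.End ℂ (H ⊗[ℂ] H)) : Module.End ℂ (H ⊗[ℂ] (H ⊗[ℂ] H)) :=
  (TensorProduct.assoc ℂ H H H).toLinearMap ∘ₗ T.rTensor H ∘ₗ
    (TensorProduct.assoc ℂ H H H).symm.toLinearMap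

/-- The operator `T₂₃` on `H ⊗ H ⊗ H`. -/
noncomputable def leg23 (T : Module.End ℂ (H ⊗[ℂ] H)) : Module.End ℂ (H ⊗[ℂ] (H ⊗[ℂ] H)) :=
  T.lTensor H

/-- The operator `T₁₃` on `H ⊗ H ⊗ H`, obtained from `T₁₂` by flipping the last two legs. -/
noncomputable def leg13 (T : Module.End ℂ (H ⊗[ℂ] H)) : Module.End ℂ (H ⊗[ℂ] (H ⊗[ℂ] H)) :=
  (TensorProduct.comm ℂ H H).toLinearMap.lTensor H ∘ₗ leg12 T ∘ₗ
    (TensorProduct.comm ℂ H H).toLinearMap.lTensor H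

/-- The underlying linear operator of a unitary `V` of `H ⊗ H`. -/
noncomputable def op (V : H ⊗[ℂ] H ≃ₗᵢ[ℂ] H ⊗[ℂ] H) : Module.End ℂ (H ⊗[ℂ] H) :=
  V.toLinearEquiv.toLinearMap

/-- The adjoint `V* = V⁻¹` of a unitary `V` of `H ⊗ H`. -/
noncomputable def opStar (V : H ⊗[ℂ] H ≃ₗᵢ[ℂ] H ⊗[ℂ] H) : Module.End ℂ (H ⊗[ℂ] H) :=
  V.symm.toLinearEquiv.toLinearMap

/-- A unitary `V` of `H ⊗ H` is multiplicative if `V₁₂ V₁₃ V₂₃ = V₂₃ V₁₂`. -/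
def IsMultiplicative (V : H ⊗[ℂ] H ≃ₗᵢ[ℂ] H ⊗[ℂ] H) : Prop :=
  leg12 (op V) * leg13 (op V) * leg23 (op V) = leg23 (op V) * leg12 (op V)

/-- The space of fixed vectors: those `ξ` with `V (ξ ⊗ η) = ξ ⊗ η` for all `η`. -/
def fixedVectors (V : H ⊗[ℂ] H ≃ₗᵢ[ℂ] H ⊗[ℂ] H) : Submodule ℂ H where
  carrier := {ξ | ∀ η : H, V (ξ ⊗ₜ[ℂ] η) = ξ ⊗ₜ[ℂ] η}
  add_mem' := by
    intro a b ha hb η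
    rw [TensorProduct.add_tmul, map_add, ha η, hb η]
  zero_mem' := by
    intro η
    rw [TensorProduct.zero_tmul, map_zero]
  smul_mem' := by
    intro c a ha η
    rw [← TensorProduct.smul_tmul', map_smul, ha η]

/-- The multiplicity of `V`: the dimension of its space of fixed vectors. -/
noncomputable def multiplicity (V : H ⊗[ℂ] H ≃ₗᵢ[ℂ] H ⊗[ℂ] H) : ℕ :=
  Module.finrank ℂ (fixedVectors V)

/-- `L(H ⊗ H)` identified with `L(H) ⊗ L(H)` (`H` is finite dimensional). -/
noncomputable def split : Module.End ℂ (H ⊗[ℂ] H) ≃ₗ[ℂ] Module.End ℂ H ⊗[ℂ] Module.End ℂ H :=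
  (homTensorHomEquiv ℂ H H H H).symm

/-- The slice `L(ω) = (ω ⊗ id)(V)`, as a linear function of `ω ∈ L(H)*`. -/
noncomputable def L (V : H ⊗[ℂ] H ≃ₗᵢ[ℂ] H ⊗[ℂ] H) :
    Module.Dual ℂ (Module.End ℂ H) →ₗ[ℂ] Module.End ℂ H where
  toFun ω := TensorProduct.lid ℂ (Module.End ℂ H) (ω.rTensor (Module.End ℂ H) (split (op V)))
  map_add' ω ω' := by simp [LinearMap.rTensor_add]
  map_smul' c ω := by simp [LinearMap.rTensor_smul]

/-- The slice `ρ(ω) = (id ⊗ ω)(V)`, as a linear function of `ω ∈ L(H)*`. -/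
noncomputable def rho (V : H ⊗[ℂ] H ≃ₗᵢ[ℂ] H ⊗[ℂ] H) :
    Module.Dual ℂ (Module.End ℂ H) →ₗ[ℂ] Module.End ℂ H where
  toFun ω := TensorProduct.rid ℂ (Module.End ℂ H) (ω.lTensor (Module.End ℂ H) (split (op V)))
  map_add' ω ω' := by simp [LinearMap.lTensor_add]
  map_smul' c ω := by simp [LinearMap.lTensor_smul]

/-- `S = {L(ω) | ω ∈ L(H)*}`. -/
noncomputable def S (V : H ⊗[ℂ] H ≃ₗᵢ[ℂ] H ⊗[ℂ] H) : Submodule ℂ (Module.End ℂ H) :=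
  LinearMap.range (L V)

/-- `Ŝ = {ρ(ω) | ω ∈ L(H)*}`. -/
noncomputable def SHat (V : H ⊗[ℂ] H ≃ₗᵢ[ℂ] H ⊗[ℂ] H) : Submodule ℂ (Module.End ℂ H) :=
  LinearMap.range (rho V)

/-- The coproduct of `S`: `δ(x) = V (x ⊗ 1) V*`. -/
noncomputable def delta (V : H ⊗[ℂ] H ≃ₗᵢ[ℂ] H ⊗[ℂ] H) (x : Module.End ℂ H) :
    Module.End ℂ (H ⊗[ℂ] H) :=
  op V * TensorProduct.map x 1 * opStar V

/-- The coproduct of `Ŝ`: `δ̂(x) = V* (1 ⊗ x) V`. -/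
noncomputable def deltaHat (V : H ⊗[ℂ] H ≃ₗᵢ[ℂ] H ⊗[ℂ] H) (x : Module.End ℂ H) :
    Module.End ℂ (H ⊗[ℂ] H) :=
  opStar V * TensorProduct.map 1 x * op V

/-- For subspaces `A, B` of `L(H)`, the subspace `A ⊗ B` of `L(H ⊗ H)`. -/
def tensorSpan (A B : Submodule ℂ (Module.End ℂ H)) : Submodule ℂ (Module.End ℂ (H ⊗[ℂ] H)) :=
  Submodule.span ℂ {T | ∃ a ∈ A, ∃ b ∈ B, T = TensorProduct.map a b}

/-- `B` is a right coideal subalgebra of `(A, δ)`, `A ⊆ L(H)`: a subalgebra with the same unit,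
not assumed to be stable under the involution, with `B ⊆ A` and `δ(B) ⊆ B ⊗ A`. -/
def IsRightCoidealSubalgebra (A : Submodule ℂ (Module.End ℂ H))
    (δ : Module.End ℂ H → Module.End ℂ (H ⊗[ℂ] H)) (B : Subalgebra ℂ (Module.End ℂ H)) : Prop :=
  B.toSubmodule ≤ A ∧ ∀ x ∈ B, δ x ∈ tensorSpan B.toSubmodule A

/-- `B` is a left coideal subalgebra of `(A, δ)`, `A ⊆ L(H)`: a subalgebra with the same unit,
not assumed to be stable under the involution, with `B ⊆ A` and `δ(B) ⊆ A ⊗ B`. -/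
def IsLeftCoidealSubalgebra (A : Submodule ℂ (Module.End ℂ H))
    (δ : Module.End ℂ H → Module.End ℂ (H ⊗[ℂ] H)) (B : Subalgebra ℂ (Module.End ℂ H)) : Prop :=
  B.toSubmodule ≤ A ∧ ∀ x ∈ B, δ x ∈ tensorSpan A B.toSubmodule

end MultUnitary

/-! Write `n = dim H`, let `τ` be the normalized trace of `L(H)` and `w = V*`. The slice `t = (id ⊗
τ)(V)` is the orthogonal projection onto the fixed vectors, so multiplicity `1` says `n τ(t) = 1`.
The pentagon equation then makes `τ` the Haar functional of `S`, makes `s = (τ ⊗ id)(V)` its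
integral, and yields the counit `ε(x) = n τ(xs)` and the antipode `κ`, which sends slices of `V` to
slices of `w`.

Let `B` be a coideal subalgebra. If `x ∈ B` and `τ(xB) = 0`, then `ε(x) = 0`: either `x` is
nilpotent and the character `ε` kills it, or some `xy` with `y` a polynomial in `x` is a nonzero
idempotent, whose trace cannot vanish. Invariance of `τ` propagates this from `x` to all slices `(id
⊗ φ)δ(x)`, so `φ(x) = 0` for every `φ`: the trace form is nondegenerate on `B` (`nondegenerate`),
without any use of the involution.

Hence some `p ∈ B` satisfies `τ(pb) = ε(b)` on `B`. In dual bases `δ(p) = ∑ cᵢ ⊗ κ(bᵢ)`, and the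
antipode identity gives `ε(p) = dim B` (`counit_integral`). As `p² = ε(p) p` and `τ(p) = 1`, the
element `p / dim B` is an idempotent of rank `n / dim B`, so `dim B` divides `n` (`finrank_dvd`).
For `B = S` the integral is `n s`, which gives `dim S = n`. Left coideals use the flipped coproduct,
and `Ŝ` uses the dual unitary `Σ V* Σ`. -/

namespace TensorSlice

/-! ### Slice maps on a tensor square. -/

variable {k E : Type*} [Field k] [Ring E] [Algebra k E]

/-- The slice map `ω ⊗ id`. -/
noncomputable def sliceLeft (ω : Module.Dual k E) : E ⊗[k] E →ₗ[k] E :=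
  (TensorProduct.lid k E).toLinearMap ∘ₗ ω.rTensor E

/-- The slice map `id ⊗ ω`. -/
noncomputable def sliceRight (ω : Module.Dual k E) : E ⊗[k] E →ₗ[k] E :=
  (TensorProduct.rid k E).toLinearMap ∘ₗ ω.lTensor E

@[simp]
theorem sliceLeft_tmul (ω : Module.Dual k E) (a b : E) : sliceLeft ω (a ⊗ₜ b) = ω a • b := by
  simp [sliceLeft]

@[simp]
theorem sliceRight_tmul (ω : Module.Dual k E) (a b : E) : sliceRight ω (a ⊗ₜ b) = ω b • a := by
  simp [sliceRight]

theorem sum_sliceRight_coord_tmul {ι : Type*} [Fintype ι] (e : Module.Basis ι k E)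
    (z : E ⊗[k] E) : ∑ j, sliceRight (e.coord j) z ⊗ₜ[k] e j = z := by
  induction z with
  | zero => simp
  | add x y hx hy => simp only [map_add, TensorProduct.add_tmul, Finset.sum_add_distrib, hx, hy]
  | tmul a b =>
    simp only [sliceRight_tmul, TensorProduct.smul_tmul, ← TensorProduct.tmul_sum,
      Module.Basis.coord_apply, e.sum_repr]

theorem eq_of_sliceRight_eq [FiniteDimensional k E] {z z' : E ⊗[k] E}
    (h : ∀ ω : Module.Dual k E, sliceRight ω z = sliceRight ω z') : z = z' := by
  rw [← sum_sliceRight_coord_tmul (Module.finBasis k E) z,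
    ← sum_sliceRight_coord_tmul (Module.finBasis k E) z']
  simp only [h]

theorem eq_of_dual_eq {x y : E} (h : ∀ φ : Module.Dual k E, φ x = φ y) : x = y := by
  rw [← sub_eq_zero, ← Module.forall_dual_apply_eq_zero_iff k]
  intro φ
  rw [map_sub, h, sub_self]

end TensorSlice

open TensorSlice

/-! ### Nondegeneracy of the trace form and integrals of coideal subalgebras. -/

/-- In a finite dimensional algebra, either `x` is nilpotent or some multiple of `x` by a
polynomial in `x` is a nonzero idempotent. -/
theorem isNilpotent_or_exists_idempotent {k E : Type*} [Field k] [Ring E] [Algebra k E]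
    [FiniteDimensional k E] (x : E) :
    IsNilpotent x ∨ ∃ y ∈ Algebra.adjoin k {x}, IsIdempotentElem (x * y) ∧ x * y ≠ 0 := by
  have hint : IsIntegral k x := Algebra.IsIntegral.isIntegral x
  obtain ⟨g, hg, hdvd⟩ := Polynomial.exists_eq_pow_rootMultiplicity_mul_and_not_dvd
    (minpoly k x) (minpoly.ne_zero hint) 0
  set m := (minpoly k x).rootMultiplicity 0
  rw [map_zero, sub_zero] at hg hdvd
  -- The exponent `m + 1`, rather than `m`, keeps the idempotent `a(x) x ^ (m + 1)` a multiple of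
  -- `x` even when `m = 0`.
  have hcop : IsCoprime (Polynomial.X ^ (m + 1)) g :=
    IsCoprime.pow_left ((Polynomial.irreducible_X.coprime_iff_not_dvd).2 hdvd)
  obtain ⟨a, b, hab⟩ := hcop
  have h0 : x ^ m * Polynomial.aeval x g = 0 := by
    have := minpoly.aeval k x
    rw [hg] at this
    simpa using this
  have h1 : Polynomial.aeval x a * x ^ (m + 1) + Polynomial.aeval x b * Polynomial.aeval x g
      = 1 := by
    have := congrArg (Polynomial.aeval x) hab
    simpa using this
  have hcc : ∀ p q : Polynomial k, Commute (Polynomial.aeval x p) (Polynomial.aeval x q) :=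
    fun p q => by rw [Commute, SemiconjBy, ← map_mul, mul_comm, map_mul]
  have hcx : ∀ q : Polynomial k, Commute x (Polynomial.aeval x q) := fun q => by
    simpa using hcc Polynomial.X q
  have hy : x * (Polynomial.aeval x a * x ^ m) = Polynomial.aeval x a * x ^ (m + 1) := by
    rw [← mul_assoc, (hcx a).eq, mul_assoc, ← pow_succ']
  have hz : x ^ (m + 1) * (Polynomial.aeval x b * Polynomial.aeval x g) = 0 := by
    rw [(hcc b g).eq, ← mul_assoc, pow_succ', mul_assoc x, h0, mul_zero, zero_mul]
  by_cases hx : x * (Polynomial.aeval x a * x ^ m) = 0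
  · left
    refine ⟨m + 1, ?_⟩
    rw [← mul_one (x ^ (m + 1)), ← h1, ← hy, hx, zero_add, hz]
  · right
    refine ⟨_, mul_mem ?_ (pow_mem (Algebra.self_mem_adjoin_singleton k x) m), ?_, hx⟩
    · exact Polynomial.aeval_mem_adjoin_singleton k x
    · rw [hy]
      set e := Polynomial.aeval x a * x ^ (m + 1)
      have : e * (e + Polynomial.aeval x b * Polynomial.aeval x g) = e * e := by
        have hez : e * (Polynomial.aeval x b * Polynomial.aeval x g) = 0 := by
          simp only [e]
          rw [mul_assoc, hz, mul_zero]
        rw [mul_add, hez, add_zero]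
      rw [IsIdempotentElem, ← this, h1, mul_one]

/-- A subalgebra `B` with a comultiplication `D`, counit `ε`, antipode `κ` and trace `τ` in
which `B` is a right coideal and `τ` is invariant on `B`. -/
structure IsInvariantCoideal {k E : Type*} [Field k] [Ring E] [Algebra k E]
    (τ ε : Module.Dual k E) (κ : E →ₗ[k] E) (D : E →ₗ[k] E ⊗[k] E) (B : Subalgebra k E) :
    Prop where
  trace_comm : ∀ a b, τ (a * b) = τ (b * a)
  idempotent : ∀ e, IsIdempotentElem e → τ e = 0 → e = 0
  counit_one : ε 1 = 1
  counit_mul : ∀ a ∈ B, ∀ b ∈ B, ε (a * b) = ε a * ε b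
  coideal : ∀ x ∈ B, ∀ φ, sliceRight φ (D x) ∈ B
  invariant : ∀ x ∈ B, ∀ b ∈ B, ∀ φ,
    τ (sliceRight φ (D x) * b) = τ (x * sliceRight (φ ∘ₗ κ) (D b))
  counit_slice : ∀ x ∈ B, ∀ φ, ε (sliceRight φ (D x)) = φ x
  -- Only the trace of the product is prescribed, so that the flipped coproduct, where the factors
  -- come in the other order, also qualifies.
  antipode : ∀ x ∈ B, τ (LinearMap.mul' k E (κ.rTensor E (D x))) = ε x
  trace_antipode : ∀ x ∈ B, ∀ y ∈ B, τ (κ x * κ y) = τ (x * y)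

namespace IsInvariantCoideal

variable {k E : Type*} [Field k] [Ring E] [Algebra k E]

/-- The trace form `(x, y) ↦ τ (x y)` on `B`. -/
noncomputable def traceForm (τ : Module.Dual k E) (B : Subalgebra k E) : LinearMap.BilinForm k B :=
  LinearMap.mk₂ k (fun x y => τ ((x : E) * (y : E)))
    (by intros; simp [add_mul]) (by intros; simp) (by intros; simp [mul_add]) (by intros; simp)

@[simp]
theorem traceForm_apply (τ : Module.Dual k E) (B : Subalgebra k E) (x y : B) : traceForm τ B x y = τ ((x : E) * (y : E)) := rfl

variable [FiniteDimensional k E]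
  {τ ε : Module.Dual k E} {κ : E →ₗ[k] E} {D : E →ₗ[k] E ⊗[k] E} {B : Subalgebra k E}

/-- A character vanishes on nilpotents; otherwise `x` generates, inside `B`, a nonzero idempotent `x
* y`, to which `h0` assigns trace zero. -/
theorem counit_eq_zero (h : IsInvariantCoideal τ ε κ D B) {x : E} (hx : x ∈ B)
    (h0 : ∀ b ∈ B, τ (x * b) = 0) : ε x = 0 := by
  have hadj : Algebra.adjoin k {x} ≤ B := Algebra.adjoin_le (by simpa using hx)
  rcases isNilpotent_or_exists_idempotent (k := k) x with ⟨m, hm⟩ | ⟨y, hy, he, hne⟩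
  · have key : ∀ m : ℕ, ε (x ^ m) = ε x ^ m := by
      intro m
      induction m with
      | zero => simp [h.counit_one]
      | succ m ih => rw [pow_succ, h.counit_mul _ (pow_mem hx m) _ hx, ih, pow_succ]
    have := key m
    rw [hm, map_zero] at this
    exact eq_zero_of_pow_eq_zero this.symm
  · exact absurd (h.idempotent _ he (h0 y (hadj hy))) hne

/-- By invariance the orthogonal of `B` is stable under the slices `(id ⊗ φ) D`. The counit kills
these slices, and it sends them to the numbers `φ x`. -/
theorem nondegenerate (h : IsInvariantCoideal τ ε κ D B) {x : E} (hx : x ∈ B)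
    (h0 : ∀ b ∈ B, τ (x * b) = 0) : x = 0 := by
  refine eq_of_dual_eq fun φ : Module.Dual k E => ?_
  rw [map_zero, ← h.counit_slice x hx φ]
  refine h.counit_eq_zero (h.coideal x hx φ) fun b hb => ?_
  rw [h.invariant x hx b hb]
  exact h0 _ (h.coideal b hb _)

theorem traceForm_nondegenerate (h : IsInvariantCoideal τ ε κ D B) :
    (traceForm τ B).Nondegenerate := by
  constructor
  · intro x hx
    exact Subtype.ext (h.nondegenerate x.2 fun b hb => hx ⟨b, hb⟩)
  · intro x hx
    refine Subtype.ext (h.nondegenerate x.2 fun b hb => ?_)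
    rw [h.trace_comm]
    exact hx ⟨b, hb⟩

/-- The counit of an integral `p` of `B` is the dimension of `B`. -/
theorem counit_integral (h : IsInvariantCoideal τ ε κ D B) {p : E} (hp : p ∈ B)
    (hpε : ∀ b ∈ B, τ (p * b) = ε b) : ε p = Module.finrank k B := by
  classical
  have hB := h.traceForm_nondegenerate
  let b := Module.finBasis k B
  let c := (traceForm τ B).dualBasis hB b
  have hcb : ∀ i j, τ ((c i : E) * (b j : E)) = if j = i then 1 else 0 := fun i j =>
    (traceForm τ B).apply_dualBasis_left hB b i j
  -- Paired with `y ∈ B`, the slice gives `τ (p * (id ⊗ φκ)(D y)) = ε ((id ⊗ φκ)(D y)) = φ (κ y)`,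
  -- which determines its coordinates in the dual basis.
  have hsl : ∀ φ, sliceRight φ (D p) = ∑ i, φ (κ (b i)) • (c i : E) := by
    intro φ
    have hmem : sliceRight φ (D p) - ∑ i, φ (κ (b i)) • (c i : E) ∈ B :=
      sub_mem (h.coideal p hp φ) (sum_mem fun i _ => B.smul_mem (c i).2 _)
    refine sub_eq_zero.1 (h.nondegenerate hmem fun y hy => ?_)
    have h1 : ∀ y ∈ B, τ (sliceRight φ (D p) * y) = φ (κ y) := by
      intro y hy
      rw [h.invariant p hp y hy, hpε _ (h.coideal y hy _), h.counit_slice y hy]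
      rfl
    rw [sub_mul, map_sub, h1 y hy, sub_eq_zero]
    have hlin : φ ∘ₗ κ ∘ₗ B.val.toLinearMap =
        τ ∘ₗ LinearMap.mulLeft k (∑ i, φ (κ (b i)) • (c i : E)) ∘ₗ B.val.toLinearMap := by
      refine b.ext fun j => ?_
      simp [Finset.sum_mul, hcb]
    exact LinearMap.congr_fun hlin ⟨y, hy⟩
  have hD : D p = ∑ i, (c i : E) ⊗ₜ[k] κ (b i) := by
    refine eq_of_sliceRight_eq fun φ => ?_
    rw [hsl, map_sum]
    simp
  -- Each summand becomes `τ (κ cᵢ * κ bᵢ) = τ (cᵢ * bᵢ) = 1`, so the sum counts the basis.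
  rw [← h.antipode p hp, hD]
  simp only [map_sum, LinearMap.rTensor_tmul, LinearMap.mul'_apply]
  simp only [h.trace_antipode _ (c _).2 _ (b _).2, hcb, if_true, Finset.sum_const,
    Finset.card_univ, Fintype.card_fin, nsmul_eq_mul, mul_one]

theorem exists_integral (h : IsInvariantCoideal τ ε κ D B) :
    ∃ p ∈ B, ∀ b ∈ B, τ (p * b) = ε b := by
  let p := ((traceForm τ B).toDual h.traceForm_nondegenerate).symm (ε ∘ₗ B.val.toLinearMap)
  refine ⟨p, p.2, fun b hb => ?_⟩
  exact LinearMap.congr_fun (((traceForm τ B).toDual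
    h.traceForm_nondegenerate).apply_symm_apply (ε ∘ₗ B.val.toLinearMap)) ⟨b, hb⟩

/-- If `n τ` takes natural values on idempotents, then the dimension of `B` divides `n`. -/
theorem finrank_dvd [CharZero k] (h : IsInvariantCoideal τ ε κ D B) {n : ℕ}
    (hn : ∀ e, IsIdempotentElem e → ∃ m : ℕ, n * τ e = m) : Module.finrank k B ∣ n := by
  obtain ⟨p, hp, hpε⟩ := h.exists_integral
  have hd := h.counit_integral hp hpε
  -- Both sides have trace pairing `ε p * ε b` with every `b ∈ B`.
  have hpp : p * p = ε p • p := by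
    refine sub_eq_zero.1 (h.nondegenerate (sub_mem (mul_mem hp hp) (B.smul_mem hp _))
      fun b hb => ?_)
    rw [sub_mul, map_sub, mul_assoc, hpε _ (mul_mem hp hb), h.counit_mul p hp b hb,
      smul_mul_assoc, map_smul, hpε b hb, smul_eq_mul, sub_self]
  have hτ : τ p = 1 := by rw [← mul_one p, hpε 1 (one_mem B), h.counit_one]
  have hne : (Module.finrank k B : k) ≠ 0 := by
    intro h0
    have hb : Module.finrank k B = 0 := by exact_mod_cast h0
    have : (1 : B) = 0 := (Module.finrank_zero_iff.1 hb).elim _ _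
    have h10 : (1 : E) = 0 := congrArg Subtype.val this
    have := h.counit_one
    rw [h10, map_zero] at this
    exact zero_ne_one this
  rw [hd] at hpp
  obtain ⟨m, hm⟩ := hn ((Module.finrank k B : k)⁻¹ • p) (by
    rw [IsIdempotentElem, smul_mul_smul_comm, hpp, smul_smul]
    congr 1
    field_simp)
  refine ⟨m, ?_⟩
  rw [map_smul, hτ, smul_eq_mul, mul_one, ← div_eq_mul_inv, div_eq_iff hne] at hm
  rw [mul_comm]
  exact_mod_cast hm

end IsInvariantCoideal

/-! ### Leg notation and contractions on triple tensors. -/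

namespace TensorSlice

variable {k E : Type*} [Field k] [Ring E] [Algebra k E]

/-- The functional `α ⊗ β`. -/
noncomputable def pair₂ (α β : Module.Dual k E) : Module.Dual k (E ⊗[k] E) :=
  LinearMap.mul' k k ∘ₗ TensorProduct.map α β

/-- The functional `α ⊗ β ⊗ γ`. -/
noncomputable def pair₃ (α β γ : Module.Dual k E) : Module.Dual k (E ⊗[k] (E ⊗[k] E)) :=
  LinearMap.mul' k k ∘ₗ TensorProduct.map α (pair₂ β γ)

/-- The slice map `ω ⊗ id ⊗ id`. -/
noncomputable def sliceFirst (ω : Module.Dual k E) : E ⊗[k] (E ⊗[k] E) →ₗ[k] E ⊗[k] E :=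
  (TensorProduct.lid k (E ⊗[k] E)).toLinearMap ∘ₗ ω.rTensor (E ⊗[k] E)

/-- `a ⊗ b ↦ a ⊗ b ⊗ 1`. -/
noncomputable def i₁₂ : E ⊗[k] E →ₐ[k] E ⊗[k] (E ⊗[k] E) :=
  Algebra.TensorProduct.map (AlgHom.id k E) Algebra.TensorProduct.includeLeft

/-- `a ⊗ b ↦ a ⊗ 1 ⊗ b`. -/
noncomputable def i₁₃ : E ⊗[k] E →ₐ[k] E ⊗[k] (E ⊗[k] E) :=
  Algebra.TensorProduct.map (AlgHom.id k E) Algebra.TensorProduct.includeRight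

/-- `a ⊗ b ↦ 1 ⊗ a ⊗ b`. -/
noncomputable def i₂₃ : E ⊗[k] E →ₐ[k] E ⊗[k] (E ⊗[k] E) :=
  Algebra.TensorProduct.includeRight

section simp_lemmas

variable (α β γ ω : Module.Dual k E) (a b c : E)

@[simp]
theorem pair₂_tmul : pair₂ α β (a ⊗ₜ b) = α a * β b := by simp [pair₂]

@[simp]
theorem pair₃_tmul (z : E ⊗[k] E) : pair₃ α β γ (a ⊗ₜ z) = α a * pair₂ β γ z := by simp [pair₃]

@[simp]
theorem sliceFirst_tmul (z : E ⊗[k] E) : sliceFirst ω (a ⊗ₜ z) = ω a • z := by simp [sliceFirst]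

@[simp]
theorem i₁₂_tmul : i₁₂ (k := k) (a ⊗ₜ b) = a ⊗ₜ (b ⊗ₜ 1) := by simp [i₁₂]

@[simp]
theorem i₁₃_tmul : i₁₃ (k := k) (a ⊗ₜ b) = a ⊗ₜ (1 ⊗ₜ b) := by simp [i₁₃]

theorem i₂₃_apply (z : E ⊗[k] E) : i₂₃ z = 1 ⊗ₜ z := by simp [i₂₃]

theorem apply_sliceLeft (z : E ⊗[k] E) : β (sliceLeft α z) = pair₂ α β z := by
  induction z with
  | zero => simp
  | add x y hx hy => simp only [map_add, hx, hy]
  | tmul a b => simp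

theorem apply_sliceRight (z : E ⊗[k] E) : α (sliceRight β z) = pair₂ α β z := by
  induction z with
  | zero => simp
  | add x y hx hy => simp only [map_add, hx, hy]
  | tmul a b => simp [mul_comm]

theorem pair₂_sliceFirst (z : E ⊗[k] (E ⊗[k] E)) :
    pair₂ α β (sliceFirst ω z) = pair₃ ω α β z := by
  induction z with
  | zero => simp
  | add x y hx hy => simp only [map_add, hx, hy]
  | tmul a b => simp

theorem mul_sliceRight (z : E ⊗[k] E) : a * sliceRight ω z = sliceRight ω (a ⊗ₜ 1 * z) := by
  induction z with
  | zero => simp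
  | add x y hx hy => simp only [map_add, mul_add, hx, hy]
  | tmul a b => simp

theorem sliceRight_mul (z : E ⊗[k] E) : sliceRight ω z * a = sliceRight ω (z * a ⊗ₜ 1) := by
  induction z with
  | zero => simp
  | add x y hx hy => simp only [map_add, add_mul, hx, hy]
  | tmul a b => simp

theorem mul_sliceLeft (z : E ⊗[k] E) : a * sliceLeft ω z = sliceLeft ω (1 ⊗ₜ a * z) := by
  induction z with
  | zero => simp
  | add x y hx hy => simp only [map_add, mul_add, hx, hy]
  | tmul a b => simp

theorem sliceLeft_mul (z : E ⊗[k] E) : sliceLeft ω z * a = sliceLeft ω (z * 1 ⊗ₜ a) := by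
  induction z with
  | zero => simp
  | add x y hx hy => simp only [map_add, add_mul, hx, hy]
  | tmul a b => simp

theorem sliceRight_comp_mulLeft (z : E ⊗[k] E) :
    sliceRight (ω ∘ₗ LinearMap.mulLeft k a) z = sliceRight ω (1 ⊗ₜ a * z) := by
  induction z with
  | zero => simp
  | add x y hx hy => simp only [map_add, mul_add, hx, hy]
  | tmul a b => simp

theorem sliceRight_comp_mulRight (z : E ⊗[k] E) :
    sliceRight (ω ∘ₗ LinearMap.mulRight k a) z = sliceRight ω (z * 1 ⊗ₜ a) := by
  induction z with
  | zero => simp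
  | add x y hx hy => simp only [map_add, add_mul, hx, hy]
  | tmul a b => simp

theorem sliceLeft_comp_mulLeft (z : E ⊗[k] E) :
    sliceLeft (ω ∘ₗ LinearMap.mulLeft k a) z = sliceLeft ω (a ⊗ₜ 1 * z) := by
  induction z with
  | zero => simp
  | add x y hx hy => simp only [map_add, mul_add, hx, hy]
  | tmul a b => simp

theorem sliceRight_comp (κ : E →ₗ[k] E) (z : E ⊗[k] E) :
    sliceRight (ω ∘ₗ κ) z = sliceRight ω (κ.lTensor E z) := by
  induction z with
  | zero => simp
  | add x y hx hy => simp only [map_add, hx, hy]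
  | tmul a b => simp

theorem sliceRight_comm (z : E ⊗[k] E) :
    sliceRight ω (TensorProduct.comm k E E z) = sliceLeft ω z := by
  induction z with
  | zero => simp
  | add x y hx hy => simp only [map_add, hx, hy]
  | tmul a b => simp

theorem sliceLeft_comm (z : E ⊗[k] E) :
    sliceLeft ω (TensorProduct.comm k E E z) = sliceRight ω z := by
  induction z with
  | zero => simp
  | add x y hx hy => simp only [map_add, hx, hy]
  | tmul a b => simp

end simp_lemmas

section legs

variable (α β γ ω : Module.Dual k E)

theorem pair₃_i₁₂_mul_i₁₃ (y z : E ⊗[k] E) :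
    pair₃ α β γ (i₁₂ y * i₁₃ z) = α (sliceRight β y * sliceRight γ z) := by
  induction y with
  | zero => simp
  | add x y hx hy => simp only [map_add, add_mul, hx, hy]
  | tmul a b =>
    induction z with
    | zero => simp
    | add x y hx hy => simp only [map_add, mul_add, hx, hy]
    | tmul c d => simp; ring

theorem pair₃_i₁₃_mul_i₂₃ (y z : E ⊗[k] E) :
    pair₃ α β γ (i₁₃ y * i₂₃ z) = γ (sliceLeft α y * sliceLeft β z) := by
  induction y with
  | zero => simp
  | add x y hx hy => simp only [map_add, add_mul, hx, hy]
  | tmul a b =>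
    induction z with
    | zero => simp
    | add x y hx hy => simp only [map_add, mul_add, hx, hy]
    | tmul c d => simp [i₂₃_apply]; ring

theorem pair₃_i₂₃_mul_i₁₃ (y z : E ⊗[k] E) :
    pair₃ α β γ (i₂₃ y * i₁₃ z) = γ (sliceLeft β y * sliceLeft α z) := by
  induction y with
  | zero => simp
  | add x y hx hy => simp only [map_add, add_mul, hx, hy]
  | tmul a b =>
    induction z with
    | zero => simp
    | add x y hx hy => simp only [map_add, mul_add, hx, hy]
    | tmul c d => simp [i₂₃_apply]

theorem pair₃_i₂₃_mul_i₁₂ (y z : E ⊗[k] E) :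
    pair₃ α β γ (i₂₃ y * i₁₂ z) = β (sliceRight γ y * sliceLeft α z) := by
  induction y with
  | zero => simp
  | add x y hx hy => simp only [map_add, add_mul, hx, hy]
  | tmul a b =>
    induction z with
    | zero => simp
    | add x y hx hy => simp only [map_add, mul_add, hx, hy]
    | tmul c d => simp [i₂₃_apply, mul_comm]

theorem pair₃_i₁₂_mul_i₂₃_mul_i₁₂ (x y z : E ⊗[k] E) :
    pair₃ α β γ (i₁₂ x * i₂₃ y * i₁₂ z) = pair₂ α β (x * 1 ⊗ₜ sliceRight γ y * z) := by
  induction x with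
  | zero => simp
  | add x y hx hy => simp only [map_add, add_mul, hx, hy]
  | tmul a b =>
    induction z with
    | zero => simp
    | add x y hx hy => simp only [map_add, mul_add, hx, hy]
    | tmul c d =>
      induction y with
      | zero => simp
      | add x y hx hy =>
        simp only [map_add, mul_add, add_mul, TensorProduct.tmul_add, hx, hy]
      | tmul p q => simp [i₂₃_apply]; ring

theorem sliceFirst_i₂₃_mul_i₁₂_mul_i₂₃ (x y z : E ⊗[k] E) :
    sliceFirst ω (i₂₃ x * i₁₂ y * i₂₃ z) = x * sliceLeft ω y ⊗ₜ 1 * z := by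
  induction y with
  | zero => simp
  | add x y hx hy =>
    simp only [map_add, mul_add, add_mul, TensorProduct.add_tmul, hx, hy]
  | tmul a b => simp [i₂₃_apply, ← TensorProduct.smul_tmul']

theorem pair₃_mul_i₁₃_tmul (c d : E) (z : E ⊗[k] (E ⊗[k] E)) :
    pair₃ α β γ (z * i₁₃ (c ⊗ₜ d)) =
      pair₃ (α ∘ₗ LinearMap.mulRight k c) β (γ ∘ₗ LinearMap.mulRight k d) z := by
  induction z with
  | zero => simp
  | add x y hx hy => simp only [map_add, add_mul, hx, hy]
  | tmul a u =>
    induction u with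
    | zero => simp
    | add x y hx hy => simp only [map_add, add_mul, TensorProduct.tmul_add, hx, hy]
    | tmul p q => simp

theorem pair₃_i₁₂_tmul_mul (c d : E) (z : E ⊗[k] (E ⊗[k] E)) :
    pair₃ α β γ (i₁₂ (c ⊗ₜ d) * z) =
      pair₃ (α ∘ₗ LinearMap.mulLeft k c) (β ∘ₗ LinearMap.mulLeft k d) γ z := by
  induction z with
  | zero => simp
  | add x y hx hy => simp only [map_add, mul_add, hx, hy]
  | tmul a u =>
    induction u with
    | zero => simp
    | add x y hx hy => simp only [map_add, mul_add, TensorProduct.tmul_add, hx, hy]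
    | tmul p q => simp

/-- With `κ.lTensor E y = w` and `z = v` this reduces the antipode identity to `w * v = 1`. -/
theorem mul_rTensor_sliceFirst (κ : E →ₗ[k] E) (y z : E ⊗[k] E) :
    LinearMap.mul' k E (κ.rTensor E (sliceFirst ω (i₁₂ y * i₁₃ z))) =
      sliceLeft ω (κ.lTensor E y * z) := by
  induction y with
  | zero => simp
  | add x y hx hy => simp only [map_add, add_mul, hx, hy]
  | tmul a b =>
    induction z with
    | zero => simp
    | add x y hx hy => simp only [map_add, mul_add, hx, hy]
    | tmul c d => simp

/-- For the flipped coproduct the factors appear in the wrong order; cyclicity of `τ` restores it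
and the identity reduces to `v * w = 1`. -/
theorem trace_mul_rTensor_comm_sliceFirst {τ : Module.Dual k E}
    (hτ : ∀ a b, τ (a * b) = τ (b * a)) (κ : E →ₗ[k] E) (y z : E ⊗[k] E) :
    τ (LinearMap.mul' k E (κ.rTensor E
      (TensorProduct.comm k E E (sliceFirst ω (i₁₂ y * i₁₃ z))))) =
      τ (sliceLeft ω (y * κ.lTensor E z)) := by
  induction y with
  | zero => simp
  | add x y hx hy => simp only [map_add, add_mul, hx, hy]
  | tmul a b =>
    induction z with
    | zero => simp
    | add x y hx hy => simp only [map_add, mul_add, hx, hy]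
    | tmul c d => simp [hτ b]

end legs

end TensorSlice

/-! ### The pentagon equation. -/

namespace TensorSlice

variable {k E : Type*} [Field k] [Ring E] [Algebra k E]

variable (k E) in
/-- The triple tensor product `E ⊗ E ⊗ E`. -/
abbrev TripleTensor : Type _ := E ⊗[k] (E ⊗[k] E)

/-- The flip of the first and third legs. -/
noncomputable def swap₁₃ : E ⊗[k] (E ⊗[k] E) ≃ₐ[k] E ⊗[k] (E ⊗[k] E) :=
  ((Algebra.TensorProduct.assoc k k k E E E).symm.trans
    (Algebra.TensorProduct.comm k (E ⊗[k] E) E)).trans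
    (Algebra.TensorProduct.congr AlgEquiv.refl (Algebra.TensorProduct.comm k E E))

theorem swap₁₃_tmul (a b c : E) : swap₁₃ (k := k) (a ⊗ₜ (b ⊗ₜ c)) = c ⊗ₜ (b ⊗ₜ a) := by
  simp [swap₁₃]

theorem swap₁₃_i₁₂ (z : E ⊗[k] E) : swap₁₃ (i₁₂ z) = i₂₃ (TensorProduct.comm k E E z) := by
  induction z with
  | zero => simp
  | add x y hx hy => simp only [map_add, hx, hy]
  | tmul a b => simp [i₂₃_apply, swap₁₃_tmul]

theorem swap₁₃_i₁₃ (z : E ⊗[k] E) : swap₁₃ (i₁₃ z) = i₁₃ (TensorProduct.comm k E E z) := by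
  induction z with
  | zero => simp
  | add x y hx hy => simp only [map_add, hx, hy]
  | tmul a b => simp [swap₁₃_tmul]

theorem swap₁₃_i₂₃ (z : E ⊗[k] E) : swap₁₃ (i₂₃ z) = i₁₂ (TensorProduct.comm k E E z) := by
  induction z with
  | zero => simp
  | add x y hx hy => simp only [map_add, hx, hy]
  | tmul a b => simp [i₂₃_apply, swap₁₃_tmul]

theorem comm_mul (x y : E ⊗[k] E) : TensorProduct.comm k E E (x * y) =
    TensorProduct.comm k E E x * TensorProduct.comm k E E y :=
  map_mul (Algebra.TensorProduct.comm k E E) x y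

theorem comm_one : TensorProduct.comm k E E (1 : E ⊗[k] E) = 1 :=
  map_one (Algebra.TensorProduct.comm k E E)

/-- Mutually inverse solutions `v`, `w` of the pentagon equation. -/
structure IsPentagon (v w : E ⊗[k] E) : Prop where
  mul_inv : v * w = 1
  inv_mul : w * v = 1
  pentagon : i₁₂ v * i₁₃ v * i₂₃ v = i₂₃ v * i₁₂ v

namespace IsPentagon

variable {v w : E ⊗[k] E}

theorem map_mul_inv {A : Type*} [Ring A] [Algebra k A] (h : IsPentagon v w)
    (f : E ⊗[k] E →ₐ[k] A) : f v * f w = 1 := by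
  rw [← map_mul, h.mul_inv, map_one]

theorem map_inv_mul {A : Type*} [Ring A] [Algebra k A] (h : IsPentagon v w)
    (f : E ⊗[k] E →ₐ[k] A) : f w * f v = 1 := by
  rw [← map_mul, h.inv_mul, map_one]

/-- The left side applies the coproduct `x ↦ v (x ⊗ 1) w` to the second leg of `v`, so coproducts of
slices can be read off. -/
theorem conj_i₁₂ (h : IsPentagon v w) : i₂₃ v * i₁₂ v * i₂₃ w = i₁₂ v * i₁₃ v := by
  rw [← h.pentagon, mul_assoc, h.map_mul_inv, mul_one]

theorem i₂₃_inv_mul_i₁₂ (h : IsPentagon v w) :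
    i₂₃ w * i₁₂ v = i₁₂ v * i₂₃ w * i₁₃ w := by
  have h1 : i₂₃ w * i₁₂ v * i₁₃ v = i₁₂ v * i₂₃ w := by
    rw [mul_assoc, ← h.conj_i₁₂, mul_assoc (i₂₃ v), ← mul_assoc (i₂₃ w), h.map_inv_mul, one_mul]
  rw [← h1, mul_assoc _ (i₁₃ v), h.map_mul_inv, mul_one]

theorem i₁₃_mul_i₂₃ (h : IsPentagon v w) : i₁₃ v * i₂₃ v = i₁₂ w * i₂₃ v * i₁₂ v := by
  rw [mul_assoc (i₁₂ w), ← h.pentagon, mul_assoc (i₁₂ v), ← mul_assoc (i₁₂ w),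
    h.map_inv_mul, one_mul]

theorem i₂₃_inv_mul_i₁₃_inv (h : IsPentagon v w) :
    i₂₃ w * i₁₃ w = i₁₂ w * i₂₃ w * i₁₂ v := by
  have h1 : (i₁₃ v * i₂₃ v) * (i₁₂ w * i₂₃ w * i₁₂ v) = 1 := by
    rw [h.i₁₃_mul_i₂₃]
    calc _ = i₁₂ w * (i₂₃ v * ((i₁₂ v * i₁₂ w) * i₂₃ w)) * i₁₂ v := by simp only [mul_assoc]
      _ = 1 := by
        rw [h.map_mul_inv, one_mul, h.map_mul_inv, mul_one, h.map_inv_mul]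
  have h2 : (i₂₃ w * i₁₃ w) * (i₁₃ v * i₂₃ v) = 1 := by
    rw [mul_assoc, ← mul_assoc (i₁₃ w), h.map_inv_mul, one_mul, h.map_inv_mul]
  exact left_inv_eq_right_inv h2 h1

/-- The flipped inverse of a solution of the pentagon equation is a solution. -/
theorem flip (h : IsPentagon v w) :
    IsPentagon (TensorProduct.comm k E E w) (TensorProduct.comm k E E v) where
  mul_inv := by rw [← comm_mul, h.inv_mul, comm_one]
  inv_mul := by rw [← comm_mul, h.mul_inv, comm_one]
  pentagon := by
    have h1 : i₂₃ w * i₁₃ w * i₁₂ w = i₁₂ w * i₂₃ w := by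
      rw [h.i₂₃_inv_mul_i₁₃_inv, mul_assoc, h.map_mul_inv, mul_one]
    have h2 := congrArg swap₁₃ h1
    simpa only [map_mul, swap₁₃_i₁₂, swap₁₃_i₁₃, swap₁₃_i₂₃] using h2

end IsPentagon

/-! ### Haar functional, counit and antipode of the right leg. -/

/-- A solution `v` of the pentagon equation together with a normalized trace `τ`, whose slices
`t` and `s` of `v` and of its inverse `w` are the integrals of the two legs. -/
structure IsIntegralPentagon (v w : E ⊗[k] E) (τ : Module.Dual k E) (t s : E) (n : ℕ) : Prop
    extends IsPentagon v w where
  trace_comm : ∀ a b, τ (a * b) = τ (b * a)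
  trace_one : τ 1 = 1
  sliceRight_left : sliceRight τ v = t
  sliceRight_inv : sliceRight τ w = t
  sliceLeft_left : sliceLeft τ v = s
  sliceLeft_inv : sliceLeft τ w = s
  mul_right : v * t ⊗ₜ 1 = t ⊗ₜ 1
  mul_left : t ⊗ₜ 1 * v = t ⊗ₜ 1
  mul_right' : v * 1 ⊗ₜ s = 1 ⊗ₜ s
  mul_left' : 1 ⊗ₜ s * v = 1 ⊗ₜ s
  trace_integral : n * τ t = 1

/-- The right leg `{(ω ⊗ id) v}` of `v`. -/
noncomputable def rightLeg (v : E ⊗[k] E) : Submodule k E where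
  carrier := {x | ∃ ω, sliceLeft ω v = x}
  add_mem' := by
    rintro _ _ ⟨ω, rfl⟩ ⟨ω', rfl⟩
    exact ⟨ω + ω', by simp [sliceLeft, LinearMap.rTensor_add]⟩
  zero_mem' := ⟨0, by simp [sliceLeft]⟩
  smul_mem' := by
    rintro c _ ⟨ω, rfl⟩
    exact ⟨c • ω, by simp [sliceLeft, LinearMap.rTensor_smul]⟩

/-- The coproduct `x ↦ v (x ⊗ 1) w`. -/
noncomputable def coprod (v w : E ⊗[k] E) : E →ₗ[k] E ⊗[k] E :=
  LinearMap.mulRight k w ∘ₗ LinearMap.mulLeft k v ∘ₗ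
    (Algebra.TensorProduct.includeLeft : E →ₐ[k] E ⊗[k] E).toLinearMap

@[simp]
theorem coprod_apply (v w : E ⊗[k] E) (x : E) : coprod v w x = v * x ⊗ₜ 1 * w := by
  simp [coprod]

/-- The counit `x ↦ n τ (x s)`. -/
noncomputable def counit (τ : Module.Dual k E) (s : E) (n : ℕ) : Module.Dual k E :=
  (n : k) • (τ ∘ₗ LinearMap.mulRight k s)

/-- The antipode `x ↦ n (τ ⊗ id) (v (s ⊗ 1) w (x ⊗ 1))`. -/
noncomputable def antipode (v w : E ⊗[k] E) (τ : Module.Dual k E) (s : E) (n : ℕ) : E →ₗ[k] E :=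
  (n : k) • (sliceLeft τ ∘ₗ LinearMap.mulLeft k (coprod v w s) ∘ₗ
    (Algebra.TensorProduct.includeLeft : E →ₐ[k] E ⊗[k] E).toLinearMap)

namespace IsIntegralPentagon

variable {v w : E ⊗[k] E} {τ : Module.Dual k E} {t s : E} {n : ℕ}

theorem inv_mul_right (h : IsIntegralPentagon v w τ t s n) : w * t ⊗ₜ 1 = t ⊗ₜ 1 := by
  rw [← h.mul_right, ← mul_assoc, h.inv_mul, one_mul, h.mul_right]

theorem inv_mul_left (h : IsIntegralPentagon v w τ t s n) : t ⊗ₜ 1 * w = t ⊗ₜ 1 := by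
  rw [← h.mul_left, mul_assoc, h.mul_inv, mul_one, h.mul_left]

theorem inv_mul_right' (h : IsIntegralPentagon v w τ t s n) : w * 1 ⊗ₜ s = 1 ⊗ₜ s := by
  rw [← h.mul_right', ← mul_assoc, h.inv_mul, one_mul, h.mul_right']

theorem inv_mul_left' (h : IsIntegralPentagon v w τ t s n) : 1 ⊗ₜ s * w = 1 ⊗ₜ s := by
  rw [← h.mul_left', mul_assoc, h.mul_inv, mul_one, h.mul_left']

/-- Both `τ s` and `τ t` equal `(τ ⊗ τ)(v)`. -/
theorem trace_integral' (h : IsIntegralPentagon v w τ t s n) : n * τ s = 1 := by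
  rw [← h.sliceLeft_left, apply_sliceLeft, ← apply_sliceRight, h.sliceRight_left,
    h.trace_integral]

theorem flip (h : IsIntegralPentagon v w τ t s n) :
    IsIntegralPentagon (TensorProduct.comm k E E w) (TensorProduct.comm k E E v) τ s t n where
  toIsPentagon := h.toIsPentagon.flip
  trace_comm := h.trace_comm
  trace_one := h.trace_one
  sliceRight_left := by rw [sliceRight_comm, h.sliceLeft_inv]
  sliceRight_inv := by rw [sliceRight_comm, h.sliceLeft_left]
  sliceLeft_left := by rw [sliceLeft_comm, h.sliceRight_inv]
  sliceLeft_inv := by rw [sliceLeft_comm, h.sliceRight_left]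
  mul_right := by simpa [comm_mul] using congrArg (TensorProduct.comm k E E) h.inv_mul_right'
  mul_left := by simpa [comm_mul] using congrArg (TensorProduct.comm k E E) h.inv_mul_left'
  mul_right' := by simpa [comm_mul] using congrArg (TensorProduct.comm k E E) h.inv_mul_right
  mul_left' := by simpa [comm_mul] using congrArg (TensorProduct.comm k E E) h.inv_mul_left
  trace_integral := h.trace_integral'

theorem coprod_sliceLeft (h : IsPentagon v w) (ω : Module.Dual k E) :
    coprod v w (sliceLeft ω v) = sliceFirst ω (i₁₂ v * i₁₃ v) := by
  rw [coprod_apply, ← sliceFirst_i₂₃_mul_i₁₂_mul_i₂₃, h.conj_i₁₂]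

theorem pair₂_coprod_sliceLeft (h : IsPentagon v w) (ω α β : Module.Dual k E) :
    pair₂ α β (coprod v w (sliceLeft ω v)) = ω (sliceRight α v * sliceRight β v) := by
  rw [coprod_sliceLeft h, pair₂_sliceFirst, pair₃_i₁₂_mul_i₁₃]

theorem trace_sliceLeft (h : IsIntegralPentagon v w τ t s n) (ω : Module.Dual k E) :
    τ (sliceLeft ω v) = ω t := by
  rw [apply_sliceLeft, ← apply_sliceRight, h.sliceRight_left]

theorem invariant_left (h : IsIntegralPentagon v w τ t s n) {b : E} (hb : b ∈ rightLeg v)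
    (φ : Module.Dual k E) : pair₂ τ φ (coprod v w b) = φ 1 * τ b := by
  obtain ⟨ω, rfl⟩ := hb
  rw [pair₂_coprod_sliceLeft h.toIsPentagon, h.sliceRight_left, mul_sliceRight, h.mul_left,
    h.trace_sliceLeft]
  simp

theorem invariant_right (h : IsIntegralPentagon v w τ t s n) {b : E} (hb : b ∈ rightLeg v)
    (φ : Module.Dual k E) : pair₂ φ τ (coprod v w b) = φ 1 * τ b := by
  obtain ⟨ω, rfl⟩ := hb
  rw [pair₂_coprod_sliceLeft h.toIsPentagon, h.sliceRight_left, sliceRight_mul, h.mul_right,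
    h.trace_sliceLeft]
  simp

theorem mul_mem_rightLeg (h : IsPentagon v w) {x y : E} (hx : x ∈ rightLeg v)
    (hy : y ∈ rightLeg v) : x * y ∈ rightLeg v := by
  obtain ⟨ω, rfl⟩ := hx
  obtain ⟨ω', rfl⟩ := hy
  -- The functional is `x ↦ (ω ⊗ ω')(w (1 ⊗ x) v)`, read off from `v₁₃ v₂₃ = w₁₂ v₂₃ v₁₂`.
  refine ⟨pair₂ ω ω' ∘ₗ LinearMap.mulRight k v ∘ₗ LinearMap.mulLeft k w ∘ₗ
    (Algebra.TensorProduct.includeRight : E →ₐ[k] E ⊗[k] E).toLinearMap, ?_⟩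
  refine eq_of_dual_eq fun β : Module.Dual k E => ?_
  rw [← pair₃_i₁₃_mul_i₂₃, h.i₁₃_mul_i₂₃, pair₃_i₁₂_mul_i₂₃_mul_i₁₂, apply_sliceLeft,
    ← apply_sliceRight]
  simp

/-- The right leg of `v`, as a subalgebra. -/
noncomputable def rightLegAlgebra (h : IsIntegralPentagon v w τ t s n) : Subalgebra k E :=
  (rightLeg v).toSubalgebra
    -- The unit is a slice because `(t ⊗ 1) v = t ⊗ 1` and `n τ(t) = 1`.
    ⟨(n : k) • (τ ∘ₗ LinearMap.mulLeft k t), by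
      have h1 : sliceLeft ((n : k) • (τ ∘ₗ LinearMap.mulLeft k t)) v =
          (n : k) • sliceLeft (τ ∘ₗ LinearMap.mulLeft k t) v := by
        simp [sliceLeft, LinearMap.rTensor_smul]
      rw [h1, sliceLeft_comp_mulLeft, h.mul_left, sliceLeft_tmul, smul_smul, h.trace_integral,
        one_smul]⟩
    fun _ _ => mul_mem_rightLeg h.toIsPentagon

theorem integral_mem (h : IsIntegralPentagon v w τ t s n) : s ∈ rightLeg v :=
  ⟨τ, h.sliceLeft_left⟩

theorem trace_conj_i₁₂_mul_i₁₃ (h : IsIntegralPentagon v w τ t s n) (ω φ : Module.Dual k E)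
    {y : E ⊗[k] E} (hy : ∀ α, sliceLeft α y ∈ rightLeg v) (z : E ⊗[k] E) :
    pair₃ ω τ φ (i₂₃ v * i₁₂ y * i₂₃ w * i₁₃ z) = ω (sliceRight τ y * sliceRight φ z) := by
  induction z with
  | zero => simp
  | add x y hx hy => simp only [map_add, mul_add, hx, hy]
  | tmul c d =>
    rw [pair₃_mul_i₁₃_tmul, ← pair₂_sliceFirst, sliceFirst_i₂₃_mul_i₁₂_mul_i₂₃,
      ← coprod_apply, h.invariant_left (hy _), apply_sliceLeft, ← apply_sliceRight]
    simp

theorem trace_i₁₂_mul_conj_i₁₂ (h : IsIntegralPentagon v w τ t s n) (ω φ : Module.Dual k E)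
    {y : E ⊗[k] E} (hy : ∀ α, sliceLeft α y ∈ rightLeg v) (z : E ⊗[k] E) :
    pair₃ ω φ τ (i₁₂ z * (i₂₃ v * i₁₂ y * i₂₃ w)) = ω (sliceRight φ z * sliceRight τ y) := by
  induction z with
  | zero => simp
  | add x y hx hy => simp only [map_add, add_mul, hx, hy]
  | tmul c d =>
    rw [pair₃_i₁₂_tmul_mul, ← pair₂_sliceFirst, sliceFirst_i₂₃_mul_i₁₂_mul_i₂₃,
      ← coprod_apply, h.invariant_right (hy _), apply_sliceLeft, ← apply_sliceRight]
    simp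

/-- Strong invariance of `τ`, before the antipode is available. The pentagon gives `δ(x)₂₃ v₁₂ = v₂₃
(1 ⊗ x)₁₂ v₁₂ w₂₃ w₁₃`; applying `τ` to the second leg collapses the conjugation by `v₂₃`, since
slices of `(1 ⊗ x) v` lie in the right leg. -/
theorem trace_sliceRight_coprod_mul (h : IsIntegralPentagon v w τ t s n) {x : E}
    (hx : x ∈ rightLeg v) (ω φ : Module.Dual k E) :
    τ (sliceRight φ (coprod v w x) * sliceLeft ω v) =
      ω (sliceRight (τ ∘ₗ LinearMap.mulLeft k x) v * sliceRight φ w) := by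
  have hy : ∀ α, sliceLeft α (1 ⊗ₜ x * v) ∈ rightLeg v := fun α => by
    rw [← mul_sliceLeft]
    exact mul_mem_rightLeg h.toIsPentagon hx ⟨α, rfl⟩
  have hx1 : i₂₃ (k := k) (x ⊗ₜ 1) = i₁₂ (1 ⊗ₜ x) := by simp [i₂₃_apply]
  have key : i₂₃ (v * x ⊗ₜ 1 * w) * i₁₂ v = i₂₃ v * i₁₂ (1 ⊗ₜ x * v) * i₂₃ w * i₁₃ w := by
    rw [map_mul, mul_assoc _ (i₂₃ w), h.i₂₃_inv_mul_i₁₂, map_mul, hx1, map_mul]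
    simp only [mul_assoc]
  rw [← pair₃_i₂₃_mul_i₁₂, sliceRight_comp_mulLeft, ← h.trace_conj_i₁₂_mul_i₁₃ _ _ hy,
    coprod_apply, key]

theorem trace_sliceLeft_coprod_mul (h : IsIntegralPentagon v w τ t s n) {x : E}
    (hx : x ∈ rightLeg v) (ω φ : Module.Dual k E) :
    τ (sliceLeft φ (coprod v w x) * sliceLeft ω v) =
      ω (sliceRight φ w * sliceRight (τ ∘ₗ LinearMap.mulLeft k x) v) := by
  have hy : ∀ α, sliceLeft α (v * 1 ⊗ₜ x) ∈ rightLeg v := fun α => by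
    rw [← sliceLeft_mul]
    exact mul_mem_rightLeg h.toIsPentagon ⟨α, rfl⟩ hx
  have hx1 : i₂₃ (k := k) (x ⊗ₜ 1) = i₁₂ (1 ⊗ₜ x) := by simp [i₂₃_apply]
  have hτ : τ ∘ₗ LinearMap.mulLeft k x = τ ∘ₗ LinearMap.mulRight k x :=
    LinearMap.ext fun a => h.trace_comm x a
  have key : i₁₃ v * i₂₃ (v * x ⊗ₜ 1 * w) =
      i₁₂ w * (i₂₃ v * i₁₂ (v * 1 ⊗ₜ x) * i₂₃ w) := by
    rw [map_mul, map_mul, ← mul_assoc, ← mul_assoc, h.i₁₃_mul_i₂₃, map_mul, hx1]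
    simp only [mul_assoc]
  rw [h.trace_comm, ← pair₃_i₁₃_mul_i₂₃, hτ, sliceRight_comp_mulRight,
    ← h.trace_i₁₂_mul_conj_i₁₂ _ _ hy, coprod_apply, key]

/-- This is strong invariance at `x = s`, where `(id ⊗ τ(s ·))(v) = τ(s) 1` and `n τ(s) = 1`. -/
theorem antipode_sliceLeft (h : IsIntegralPentagon v w τ t s n) (ω : Module.Dual k E) :
    antipode v w τ s n (sliceLeft ω v) = sliceLeft ω w := by
  refine eq_of_dual_eq fun φ : Module.Dual k E => ?_
  have h1 : φ (antipode v w τ s n (sliceLeft ω v)) =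
      n * τ (sliceRight φ (coprod v w s) * sliceLeft ω v) := by
    rw [sliceRight_mul, apply_sliceRight, ← apply_sliceLeft]
    simp [antipode, mul_assoc]
  rw [h1, h.trace_sliceRight_coprod_mul h.integral_mem, sliceRight_comp_mulLeft, h.mul_left',
    sliceRight_tmul, smul_mul_assoc, one_mul, map_smul, smul_eq_mul, ← mul_assoc,
    h.trace_integral', one_mul, apply_sliceLeft, apply_sliceRight]

theorem sliceRight_comp_antipode (h : IsIntegralPentagon v w τ t s n) (φ : Module.Dual k E) :
    sliceRight (φ ∘ₗ antipode v w τ s n) v = sliceRight φ w := by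
  refine eq_of_dual_eq fun ω : Module.Dual k E => ?_
  rw [apply_sliceRight, ← apply_sliceLeft, LinearMap.comp_apply, h.antipode_sliceLeft,
    apply_sliceLeft, apply_sliceRight]

theorem sliceRight_counit (h : IsIntegralPentagon v w τ t s n) :
    sliceRight (counit τ s n) v = 1 := by
  have h1 : sliceRight (counit τ s n) v = (n : k) • sliceRight (τ ∘ₗ LinearMap.mulRight k s) v := by
    simp [sliceRight, counit, LinearMap.lTensor_smul]
  rw [h1, sliceRight_comp_mulRight, h.mul_right', sliceRight_tmul, smul_smul, h.trace_integral',
    one_smul]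

theorem counit_sliceLeft (h : IsIntegralPentagon v w τ t s n) (ω : Module.Dual k E) :
    counit τ s n (sliceLeft ω v) = ω 1 := by
  rw [apply_sliceLeft, ← apply_sliceRight, h.sliceRight_counit]

theorem mul_integral (h : IsIntegralPentagon v w τ t s n) {x : E} (hx : x ∈ rightLeg v) :
    x * s = counit τ s n x • s := by
  obtain ⟨ω, rfl⟩ := hx
  rw [h.counit_sliceLeft, sliceLeft_mul, h.mul_right', sliceLeft_tmul]

/-- Multiplicativity comes from `y * s = ε(y) s`. -/
theorem counit_mul (h : IsIntegralPentagon v w τ t s n) (x : E) {y : E} (hy : y ∈ rightLeg v) :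
    counit τ s n (x * y) = counit τ s n x * counit τ s n y := by
  have h1 : counit τ s n (x * y) = n * τ (x * (y * s)) := by simp [counit, mul_assoc]
  rw [h1, h.mul_integral hy]
  simp only [counit, LinearMap.smul_apply, LinearMap.comp_apply, LinearMap.mulRight_apply,
    mul_smul_comm, map_smul, smul_eq_mul]
  ring

/-- After one cyclic swap the two sides contract `w₂₃ w₁₃ = w₁₂ w₂₃ v₁₂` and `v₁₃ v₂₃ = w₁₂ v₂₃ v₁₂`
with `τ` on the third leg; they agree since `v` and `w` have the same slice `t`. -/
theorem trace_antipode (h : IsIntegralPentagon v w τ t s n) {x y : E} (hx : x ∈ rightLeg v)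
    (hy : y ∈ rightLeg v) : τ (antipode v w τ s n x * antipode v w τ s n y) = τ (x * y) := by
  obtain ⟨ω, rfl⟩ := hx
  obtain ⟨ω', rfl⟩ := hy
  rw [h.antipode_sliceLeft, h.antipode_sliceLeft, h.trace_comm, ← pair₃_i₂₃_mul_i₁₃,
    ← pair₃_i₁₃_mul_i₂₃, h.i₂₃_inv_mul_i₁₃_inv, h.i₁₃_mul_i₂₃, pair₃_i₁₂_mul_i₂₃_mul_i₁₂,
    pair₃_i₁₂_mul_i₂₃_mul_i₁₂, h.sliceRight_left, h.sliceRight_inv]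

variable [FiniteDimensional k E]

theorem lTensor_antipode (h : IsIntegralPentagon v w τ t s n) :
    (antipode v w τ s n).lTensor E v = w :=
  eq_of_sliceRight_eq fun φ => by rw [← sliceRight_comp, h.sliceRight_comp_antipode]

theorem isInvariantCoideal_right (h : IsIntegralPentagon v w τ t s n)
    (hτ : ∀ e, IsIdempotentElem e → τ e = 0 → e = 0) {B : Subalgebra k E}
    (hB : ∀ x ∈ B, x ∈ rightLeg v)
    (hcoid : ∀ x ∈ B, ∀ φ, sliceRight φ (coprod v w x) ∈ B) :
    IsInvariantCoideal τ (counit τ s n) (antipode v w τ s n) (coprod v w) B where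
  trace_comm := h.trace_comm
  idempotent := hτ
  counit_one := by simp [counit, h.trace_integral']
  counit_mul a _ b hb := h.counit_mul a (hB b hb)
  coideal := hcoid
  invariant := by
    intro x hx b hb φ
    obtain ⟨ω, rfl⟩ := hB b hb
    rw [h.trace_sliceRight_coprod_mul (hB x hx), ← h.sliceRight_comp_antipode φ,
      ← pair₂_coprod_sliceLeft h.toIsPentagon, ← apply_sliceRight]
    rfl
  counit_slice := by
    intro x hx φ
    obtain ⟨ω, rfl⟩ := hB x hx
    rw [apply_sliceRight, pair₂_coprod_sliceLeft h.toIsPentagon, h.sliceRight_counit, one_mul,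
      apply_sliceLeft, apply_sliceRight]
  antipode := by
    intro x hx
    obtain ⟨ω, rfl⟩ := hB x hx
    rw [coprod_sliceLeft h.toIsPentagon, mul_rTensor_sliceFirst, h.lTensor_antipode, h.inv_mul,
      h.counit_sliceLeft, Algebra.TensorProduct.one_def, sliceLeft_tmul, map_smul, h.trace_one,
      smul_eq_mul, mul_one]
  trace_antipode x hx y hy := h.trace_antipode (hB x hx) (hB y hy)

theorem isInvariantCoideal_left (h : IsIntegralPentagon v w τ t s n)
    (hτ : ∀ e, IsIdempotentElem e → τ e = 0 → e = 0) {B : Subalgebra k E}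
    (hB : ∀ x ∈ B, x ∈ rightLeg v)
    (hcoid : ∀ x ∈ B, ∀ φ, sliceLeft φ (coprod v w x) ∈ B) :
    IsInvariantCoideal τ (counit τ s n) (antipode v w τ s n)
      ((TensorProduct.comm k E E).toLinearMap ∘ₗ coprod v w) B where
  trace_comm := h.trace_comm
  idempotent := hτ
  counit_one := by simp [counit, h.trace_integral']
  counit_mul a _ b hb := h.counit_mul a (hB b hb)
  coideal x hx φ := by
    rw [LinearMap.comp_apply, LinearEquiv.coe_coe, sliceRight_comm]
    exact hcoid x hx φ
  invariant := by
    intro x hx b hb φ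
    obtain ⟨ω, rfl⟩ := hB b hb
    simp only [LinearMap.comp_apply, LinearEquiv.coe_coe, sliceRight_comm]
    rw [h.trace_sliceLeft_coprod_mul (hB x hx), ← h.sliceRight_comp_antipode φ,
      ← pair₂_coprod_sliceLeft h.toIsPentagon, ← apply_sliceLeft]
    rfl
  counit_slice := by
    intro x hx φ
    obtain ⟨ω, rfl⟩ := hB x hx
    rw [LinearMap.comp_apply, LinearEquiv.coe_coe, sliceRight_comm, apply_sliceLeft,
      pair₂_coprod_sliceLeft h.toIsPentagon, h.sliceRight_counit, mul_one,
      apply_sliceLeft, apply_sliceRight]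
  antipode := by
    intro x hx
    obtain ⟨ω, rfl⟩ := hB x hx
    rw [LinearMap.comp_apply, LinearEquiv.coe_coe, coprod_sliceLeft h.toIsPentagon,
      trace_mul_rTensor_comm_sliceFirst _ h.trace_comm, h.lTensor_antipode, h.mul_inv,
      h.counit_sliceLeft, Algebra.TensorProduct.one_def, sliceLeft_tmul, map_smul, h.trace_one,
      smul_eq_mul, mul_one]
  trace_antipode x hx y hy := h.trace_antipode (hB x hx) (hB y hy)

theorem finrank_rightLeg [CharZero k] (h : IsIntegralPentagon v w τ t s n)
    (hτ : ∀ e, IsIdempotentElem e → τ e = 0 → e = 0) : Module.finrank k (rightLeg v) = n := by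
  have hcoid : ∀ x ∈ h.rightLegAlgebra, ∀ φ,
      sliceRight φ (coprod v w x) ∈ h.rightLegAlgebra := by
    rintro _ ⟨ω, rfl⟩ φ
    refine ⟨ω ∘ₗ LinearMap.mulRight k (sliceRight φ v), ?_⟩
    refine eq_of_dual_eq fun α : Module.Dual k E => ?_
    rw [apply_sliceRight, pair₂_coprod_sliceLeft h.toIsPentagon, apply_sliceLeft,
      ← apply_sliceRight]
    rfl
  have hI := h.isInvariantCoideal_right hτ (B := h.rightLegAlgebra) (fun _ hx => hx) hcoid
  -- The integral of the whole leg is `n s`, directly from the definition of the counit.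
  have hp := hI.counit_integral (h.rightLegAlgebra.smul_mem h.integral_mem (n : k)) (by
    intro b hb
    rw [h.trace_comm, mul_smul_comm, map_smul]
    rfl)
  have h1 : counit τ s n s = 1 := by
    have := h.counit_sliceLeft τ
    rwa [h.sliceLeft_left, h.trace_one] at this
  rw [map_smul, h1, smul_eq_mul, mul_one] at hp
  exact_mod_cast hp.symm

/-- The left leg of `v` is the right leg of the flipped inverse of `v`. -/
theorem rightLeg_comm_inv (h : IsIntegralPentagon v w τ t s n) :
    rightLeg (TensorProduct.comm k E E w) = rightLeg (TensorProduct.comm k E E v) := by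
  have hle : rightLeg (TensorProduct.comm k E E w) ≤ rightLeg (TensorProduct.comm k E E v) := by
    rintro _ ⟨ω, rfl⟩
    refine ⟨ω ∘ₗ antipode v w τ s n, ?_⟩
    rw [sliceLeft_comm, sliceLeft_comm, h.sliceRight_comp_antipode]
  refine Submodule.eq_of_le_of_finrank_le hle ?_
  -- The antipode of the flipped solution maps the smaller space onto a space containing the larger
  -- one, so the dimensions agree.
  have hmap : rightLeg (TensorProduct.comm k E E v) ≤ (rightLeg (TensorProduct.comm k E E w)).map
      (antipode (TensorProduct.comm k E E w) (TensorProduct.comm k E E v) τ t n) := by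
    rintro _ ⟨ω, rfl⟩
    exact ⟨_, ⟨ω, rfl⟩, h.flip.antipode_sliceLeft ω⟩
  exact (Submodule.finrank_mono hmap).trans (Submodule.finrank_map_le _ _)

end IsIntegralPentagon

end TensorSlice

/-! ### From multiplicative unitaries to the algebraic pentagon. -/

namespace MultUnitary

open TensorSlice

variable {H : Type*} [NormedAddCommGroup H] [InnerProductSpace ℂ H]

/-- The multiplicative inverse of `split`. -/
noncomputable def unsplit :
    Module.End ℂ H ⊗[ℂ] Module.End ℂ H →ₐ[ℂ] Module.End ℂ (H ⊗[ℂ] H) :=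
  Module.endTensorEndAlgHom

@[simp]
theorem unsplit_tmul (a b : Module.End ℂ H) : unsplit (a ⊗ₜ b) = TensorProduct.map a b := by
  simp [unsplit, Module.endTensorEndAlgHom_apply, TensorProduct.AlgebraTensorModule.map_eq]

/-- The identification of `L(H) ⊗ L(H) ⊗ L(H)` with `L(H ⊗ H ⊗ H)`. -/
noncomputable def unsplit₃ : TripleTensor ℂ (Module.End ℂ H) →ₐ[ℂ]
    Module.End ℂ (H ⊗[ℂ] (H ⊗[ℂ] H)) :=
  Module.endTensorEndAlgHom.comp (Algebra.TensorProduct.map (AlgHom.id ℂ _) unsplit)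

theorem unsplit₃_tmul (a : Module.End ℂ H) (z : Module.End ℂ H ⊗[ℂ] Module.End ℂ H) :
    unsplit₃ (a ⊗ₜ z) = TensorProduct.map a (unsplit z) := by
  simp [unsplit₃, Module.endTensorEndAlgHom_apply, TensorProduct.AlgebraTensorModule.map_eq]

theorem unsplit₃_i₁₂ (z : Module.End ℂ H ⊗[ℂ] Module.End ℂ H) :
    unsplit₃ (i₁₂ z) = leg12 (unsplit z) := by
  induction z with
  | zero => simp [leg12]
  | add x y hx hy =>
    simp only [map_add, hx, hy, leg12, LinearMap.rTensor_add, LinearMap.add_comp,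
      LinearMap.comp_add]
  | tmul a b =>
    rw [i₁₂_tmul, unsplit₃_tmul, unsplit_tmul, unsplit_tmul, leg12]
    refine TensorProduct.ext' fun x y => ?_
    induction y with
    | zero => simp
    | add x y hx hy => simp only [TensorProduct.tmul_add, map_add, hx, hy]
    | tmul p q => simp

theorem unsplit₃_i₂₃ (z : Module.End ℂ H ⊗[ℂ] Module.End ℂ H) :
    unsplit₃ (i₂₃ z) = leg23 (unsplit z) := by
  rw [i₂₃_apply, unsplit₃_tmul, leg23]
  rfl

theorem unsplit₃_i₁₃ (z : Module.End ℂ H ⊗[ℂ] Module.End ℂ H) :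
    unsplit₃ (i₁₃ z) = leg13 (unsplit z) := by
  induction z with
  | zero => simp [leg13, leg12]
  | add x y hx hy =>
    simp only [map_add, hx, hy, leg13, leg12, LinearMap.rTensor_add, LinearMap.add_comp,
      LinearMap.comp_add]
  | tmul a b =>
    rw [i₁₃_tmul, unsplit₃_tmul, unsplit_tmul, unsplit_tmul, leg13, leg12]
    refine TensorProduct.ext' fun x y => ?_
    induction y with
    | zero => simp
    | add x y hx hy => simp only [TensorProduct.tmul_add, map_add, hx, hy]
    | tmul p q => simp

theorem unsplit_comm (z : Module.End ℂ H ⊗[ℂ] Module.End ℂ H) (x : H ⊗[ℂ] H) :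
    unsplit (TensorProduct.comm ℂ _ _ z) x =
      TensorProduct.comm ℂ H H (unsplit z (TensorProduct.comm ℂ H H x)) := by
  induction z with
  | zero => simp
  | add a b ha hb => simp only [map_add, LinearMap.add_apply, ha, hb]
  | tmul a b =>
    induction x with
    | zero => simp
    | add a b ha hb => simp only [map_add, ha, hb]
    | tmul x y => simp

theorem op_mul_opStar (V : H ⊗[ℂ] H ≃ₗᵢ[ℂ] H ⊗[ℂ] H) : op V * opStar V = 1 :=
  LinearMap.ext fun x => V.apply_symm_apply x

theorem opStar_mul_op (V : H ⊗[ℂ] H ≃ₗᵢ[ℂ] H ⊗[ℂ] H) : opStar V * op V = 1 :=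
  LinearMap.ext fun x => V.symm_apply_apply x

variable (H) in
/-- The normalized trace. -/
noncomputable def normTrace : Module.Dual ℂ (Module.End ℂ H) :=
  (Module.finrank ℂ H : ℂ)⁻¹ • LinearMap.trace ℂ H

theorem normTrace_comm (a b : Module.End ℂ H) : normTrace H (a * b) = normTrace H (b * a) := by
  simp [normTrace, LinearMap.trace_mul_comm ℂ a b]

theorem finrank_mul_normTrace (hn : (Module.finrank ℂ H : ℂ) ≠ 0) (a : Module.End ℂ H) :
    Module.finrank ℂ H * normTrace H a = LinearMap.trace ℂ H a := by
  simp [normTrace, hn]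

variable [FiniteDimensional ℂ H]

theorem unsplit_eq (z : Module.End ℂ H ⊗[ℂ] Module.End ℂ H) : unsplit z = split.symm z := by
  induction z with
  | zero => simp
  | add x y hx hy => simp only [map_add, hx, hy]
  | tmul a b => simp [split]

theorem split_unsplit (z : Module.End ℂ H ⊗[ℂ] Module.End ℂ H) : split (unsplit z) = z := by
  rw [unsplit_eq, LinearEquiv.apply_symm_apply]

theorem unsplit_split (T : Module.End ℂ (H ⊗[ℂ] H)) : unsplit (split T) = T := by
  rw [unsplit_eq, LinearEquiv.symm_apply_apply]

theorem unsplit_injective : Function.Injective (unsplit (H := H)) :=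
  Function.LeftInverse.injective split_unsplit

theorem split_map (a b : Module.End ℂ H) : split (TensorProduct.map a b) = a ⊗ₜ b := by
  rw [← unsplit_tmul, split_unsplit]

theorem split_mul (S T : Module.End ℂ (H ⊗[ℂ] H)) : split (S * T) = split S * split T := by
  apply unsplit_injective
  rw [unsplit_split, map_mul unsplit, unsplit_split, unsplit_split]

theorem split_one : split (1 : Module.End ℂ (H ⊗[ℂ] H)) = 1 := by
  apply unsplit_injective
  rw [unsplit_split, Algebra.TensorProduct.one_def, unsplit_tmul, TensorProduct.map_one]

theorem unsplit₃_injective : Function.Injective (unsplit₃ (H := H)) := by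
  have h : ∀ z, unsplit₃ (H := H) z =
      homTensorHomEquiv ℂ H (H ⊗[ℂ] H) H (H ⊗[ℂ] H)
        ((split (H := H)).symm.toLinearMap.lTensor (Module.End ℂ H) z) := by
    intro z
    induction z using TensorProduct.induction_on with
    | zero => simp
    | add x y hx hy => simp only [map_add, hx, hy]
    | tmul a b => simp [unsplit₃_tmul, unsplit_eq]
  intro x y hxy
  rw [h, h] at hxy
  exact (LinearEquiv.lTensor (Module.End ℂ H) (split (H := H)).symm).injective
    ((homTensorHomEquiv ℂ H (H ⊗[ℂ] H) H (H ⊗[ℂ] H)).injective hxy)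

theorem IsMultiplicative.isPentagon {V : H ⊗[ℂ] H ≃ₗᵢ[ℂ] H ⊗[ℂ] H} (hV : IsMultiplicative V) :
    IsPentagon (split (op V)) (split (opStar V)) where
  mul_inv := by rw [← split_mul, op_mul_opStar, split_one]
  inv_mul := by rw [← split_mul, opStar_mul_op, split_one]
  pentagon := by
    apply unsplit₃_injective
    simp only [map_mul, unsplit₃_i₁₂, unsplit₃_i₁₃, unsplit₃_i₂₃, unsplit_split]
    exact hV

theorem normTrace_one (hn : (Module.finrank ℂ H : ℂ) ≠ 0) : normTrace H 1 = 1 := by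
  simp [normTrace, hn]

theorem inner_sliceRight_normTrace (z : Module.End ℂ H ⊗[ℂ] Module.End ℂ H) (x y : H) :
    inner ℂ x (sliceRight (normTrace H) z y) = (Module.finrank ℂ H : ℂ)⁻¹ *
      ∑ i, inner ℂ (x ⊗ₜ[ℂ] stdOrthonormalBasis ℂ H i)
        (unsplit z (y ⊗ₜ[ℂ] stdOrthonormalBasis ℂ H i)) := by
  induction z with
  | zero => simp
  | add a b ha hb =>
    simp only [map_add, LinearMap.add_apply, inner_add_right, ha, hb, Finset.sum_add_distrib,
      mul_add]
  | tmul a b =>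
    simp only [sliceRight_tmul, LinearMap.smul_apply, inner_smul_right, unsplit_tmul,
      TensorProduct.map_tmul, TensorProduct.inner_tmul, ← Finset.mul_sum,
      ← LinearMap.trace_eq_sum_inner, normTrace, smul_eq_mul]
    ring

section unitary

variable {V : H ⊗[ℂ] H ≃ₗᵢ[ℂ] H ⊗[ℂ] H}

theorem adjoint_op : LinearMap.adjoint (op V) = opStar V := by
  symm
  rw [LinearMap.eq_adjoint_iff]
  intro x y
  exact (V.symm.inner_map_eq_flip x y)

theorem sliceRight_normTrace_apply_of_fixed (hn : (Module.finrank ℂ H : ℂ) ≠ 0)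
    {T : Module.End ℂ (H ⊗[ℂ] H)} {x : H} (hx : ∀ y : H, T (x ⊗ₜ[ℂ] y) = x ⊗ₜ[ℂ] y) :
    sliceRight (normTrace H) (split T) x = x := by
  refine ext_inner_left ℂ fun y => ?_
  rw [inner_sliceRight_normTrace, unsplit_split]
  simp [hx, hn]

/-- Equality case of Cauchy–Schwarz: the average of `⟨x ⊗ eᵢ, V (x ⊗ eᵢ)⟩` equals `‖x‖²`, so the sum
of the `‖V (x ⊗ eᵢ) - x ⊗ eᵢ‖²` is zero. -/
theorem fixed_of_sliceRight_normTrace_apply (hn : (Module.finrank ℂ H : ℂ) ≠ 0) {x : H}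
    (hx : sliceRight (normTrace H) (split (op V)) x = x) : x ∈ fixedVectors V := by
  set e := stdOrthonormalBasis ℂ H
  have h1 : ∑ i, inner ℂ (x ⊗ₜ[ℂ] e i) (V (x ⊗ₜ[ℂ] e i)) = Module.finrank ℂ H * inner ℂ x x := by
    have := inner_sliceRight_normTrace (split (op V)) x x
    rw [hx, unsplit_split, eq_inv_mul_iff_mul_eq₀ hn] at this
    exact this.symm
  have h2 : ∑ i, ‖V (x ⊗ₜ[ℂ] e i) - x ⊗ₜ[ℂ] e i‖ ^ 2 = 0 := by
    have h3 : ∀ i, ‖V (x ⊗ₜ[ℂ] e i) - x ⊗ₜ[ℂ] e i‖ ^ 2 =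
        2 * ‖x‖ ^ 2 - 2 * (inner ℂ (x ⊗ₜ[ℂ] e i) (V (x ⊗ₜ[ℂ] e i))).re := by
      intro i
      rw [norm_sub_sq (𝕜 := ℂ), V.norm_map, TensorProduct.norm_tmul, e.norm_eq_one,
        inner_re_symm]
      simp only [mul_one, RCLike.re_to_complex]
      ring
    simp only [h3, Finset.sum_sub_distrib, ← Finset.mul_sum, ← Complex.re_sum, h1]
    rw [inner_self_eq_norm_sq_to_K]
    have h5 : (((Module.finrank ℂ H : ℕ) : ℂ) * ((‖x‖ : ℝ) : ℂ) ^ 2).re =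
        Module.finrank ℂ H * ‖x‖ ^ 2 := by
      norm_cast
    simp only [Complex.coe_algebraMap, h5, Finset.sum_const, Finset.card_univ, Fintype.card_fin,
      nsmul_eq_mul]
    ring
  rw [Finset.sum_eq_zero_iff_of_nonneg (fun _ _ => sq_nonneg _)] at h2
  have h4 : ∀ i, V (x ⊗ₜ[ℂ] e i) = x ⊗ₜ[ℂ] e i := fun i => by
    have := h2 i (Finset.mem_univ i)
    rwa [sq_eq_zero_iff, norm_eq_zero, sub_eq_zero] at this
  intro y
  rw [← e.sum_repr y, TensorProduct.tmul_sum, map_sum]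
  simp only [TensorProduct.tmul_smul, map_smul, h4]

theorem sliceRight_normTrace_inv :
    sliceRight (normTrace H) (split (opStar V)) =
      LinearMap.adjoint (sliceRight (normTrace H) (split (op V))) := by
  rw [LinearMap.eq_adjoint_iff]
  intro x y
  rw [← inner_conj_symm, inner_sliceRight_normTrace, inner_sliceRight_normTrace, map_mul,
    map_sum, unsplit_split, unsplit_split, map_inv₀, Complex.conj_natCast]
  congr 1
  refine Finset.sum_congr rfl fun i _ => ?_
  exact (inner_conj_symm _ _).trans (V.symm.inner_map_eq_flip _ _)

/-- Idempotence holds because `ω (t * t) = (τ ⊗ τ)(V (x ⊗ 1) V*) = τ x = ω t` for `x = (ω ⊗ id)(V)`,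
as `τ ⊗ τ` is a trace. Its range then consists of vectors with `t x = x`, which are fixed. -/
theorem isProj_fixedVectors (hn : (Module.finrank ℂ H : ℂ) ≠ 0)
    (h : IsPentagon (split (op V)) (split (opStar V))) :
    LinearMap.IsProj (fixedVectors V) (sliceRight (normTrace H) (split (op V))) := by
  set t := sliceRight (normTrace H) (split (op V)) with ht
  have htt : t * t = t := by
    refine eq_of_dual_eq fun ω : Module.Dual ℂ (Module.End ℂ H) => ?_
    have hcomm : ∀ x y : Module.End ℂ H ⊗[ℂ] Module.End ℂ H,
        pair₂ (normTrace H) (normTrace H) (x * y) =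
          pair₂ (normTrace H) (normTrace H) (y * x) := by
      intro x y
      induction x with
      | zero => simp
      | add x y hx hy => simp only [map_add, add_mul, mul_add, hx, hy]
      | tmul a b =>
        induction y with
        | zero => simp
        | add x y hx hy => simp only [map_add, add_mul, mul_add, hx, hy]
        | tmul c d => simp [normTrace_comm a, normTrace_comm b]
    rw [← IsIntegralPentagon.pair₂_coprod_sliceLeft h, coprod_apply, mul_assoc, hcomm, mul_assoc,
      h.inv_mul, mul_one, pair₂_tmul, normTrace_one hn, mul_one, apply_sliceLeft,
      ← apply_sliceRight]
  refine ⟨fun x => fixed_of_sliceRight_normTrace_apply hn ?_, fun x hx => ?_⟩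
  · exact LinearMap.congr_fun htt x
  · exact sliceRight_normTrace_apply_of_fixed hn hx

/-- `V*` fixes what `V` fixes, so `t* t = t`; the left side is self-adjoint, hence so is `t`. -/
theorem sliceRight_normTrace_symm (hn : (Module.finrank ℂ H : ℂ) ≠ 0)
    (h : IsPentagon (split (op V)) (split (opStar V))) :
    sliceRight (normTrace H) (split (opStar V)) = sliceRight (normTrace H) (split (op V)) := by
  have hP := isProj_fixedVectors hn h
  have h1 : sliceRight (normTrace H) (split (opStar V)) *
      sliceRight (normTrace H) (split (op V)) = sliceRight (normTrace H) (split (op V)) := by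
    refine LinearMap.ext fun x => sliceRight_normTrace_apply_of_fixed hn fun y => ?_
    exact (V.symm_apply_eq).2 (hP.map_mem x y).symm
  have h2 := congrArg LinearMap.adjoint h1
  rw [sliceRight_normTrace_inv] at h1 h2 ⊢
  rw [← h2, Module.End.mul_eq_comp, LinearMap.adjoint_comp, LinearMap.adjoint_adjoint,
    ← Module.End.mul_eq_comp, h1]

theorem op_mul_sliceRight (hn : (Module.finrank ℂ H : ℂ) ≠ 0)
    (h : IsPentagon (split (op V)) (split (opStar V))) :
    op V * TensorProduct.map (sliceRight (normTrace H) (split (op V))) 1 =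
      TensorProduct.map (sliceRight (normTrace H) (split (op V))) 1 := by
  refine TensorProduct.ext' fun x y => ?_
  exact (isProj_fixedVectors hn h).map_mem x y

theorem sliceRight_mul_op (hn : (Module.finrank ℂ H : ℂ) ≠ 0)
    (h : IsPentagon (split (op V)) (split (opStar V))) :
    TensorProduct.map (sliceRight (normTrace H) (split (op V))) 1 * op V =
      TensorProduct.map (sliceRight (normTrace H) (split (op V))) 1 := by
  have h1 : opStar V * TensorProduct.map (sliceRight (normTrace H) (split (op V))) 1 =
      TensorProduct.map (sliceRight (normTrace H) (split (op V))) 1 := by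
    rw [← op_mul_sliceRight hn h, ← mul_assoc, opStar_mul_op, one_mul, op_mul_sliceRight hn h]
  have h2 := congrArg LinearMap.adjoint h1
  rw [Module.End.mul_eq_comp, LinearMap.adjoint_comp, TensorProduct.adjoint_map,
    ← sliceRight_normTrace_inv, sliceRight_normTrace_symm hn h, ← adjoint_op,
    LinearMap.adjoint_adjoint, ← Module.End.mul_eq_comp] at h2
  simpa using h2

end unitary

end MultUnitary

/-! ### The dual unitary and the final divisibility. -/

namespace MultUnitary

open TensorSlice

variable {H : Type*} [NormedAddCommGroup H] [InnerProductSpace ℂ H] [FiniteDimensional ℂ H]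

theorem eq_zero_of_normTrace_eq_zero (hn : (Module.finrank ℂ H : ℂ) ≠ 0) (e : Module.End ℂ H)
    (he : IsIdempotentElem e) (h0 : normTrace H e = 0) : e = 0 := by
  refine LinearMap.IsIdempotentElem.eq_zero_of_trace_eq_zero he ?_
  rw [← finrank_mul_normTrace hn, h0, mul_zero]

theorem exists_natCast_eq_normTrace (hn : (Module.finrank ℂ H : ℂ) ≠ 0) (e : Module.End ℂ H)
    (he : IsIdempotentElem e) : ∃ m : ℕ, Module.finrank ℂ H * normTrace H e = m := by
  refine ⟨Module.finrank ℂ (LinearMap.range e), ?_⟩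
  rw [finrank_mul_normTrace hn]
  exact ((LinearMap.isProj_range_iff_isIdempotentElem e).2 he).trace

/-- The dual unitary `Σ V* Σ`. -/
noncomputable def dualUnitary (V : H ⊗[ℂ] H ≃ₗᵢ[ℂ] H ⊗[ℂ] H) : H ⊗[ℂ] H ≃ₗᵢ[ℂ] H ⊗[ℂ] H :=
  ((TensorProduct.commIsometry ℂ H H).trans V.symm).trans (TensorProduct.commIsometry ℂ H H)

theorem split_op_dualUnitary (V : H ⊗[ℂ] H ≃ₗᵢ[ℂ] H ⊗[ℂ] H) :
    split (op (dualUnitary V)) = TensorProduct.comm ℂ _ _ (split (opStar V)) := by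
  apply unsplit_injective
  refine LinearMap.ext fun x => ?_
  rw [unsplit_comm, unsplit_split, unsplit_split]
  rfl

theorem split_opStar_dualUnitary (V : H ⊗[ℂ] H ≃ₗᵢ[ℂ] H ⊗[ℂ] H) :
    split (opStar (dualUnitary V)) = TensorProduct.comm ℂ _ _ (split (op V)) := by
  apply unsplit_injective
  refine LinearMap.ext fun x => ?_
  rw [unsplit_comm, unsplit_split, unsplit_split]
  rfl

theorem split_op_mul_sliceRight {V : H ⊗[ℂ] H ≃ₗᵢ[ℂ] H ⊗[ℂ] H}
    (hn : (Module.finrank ℂ H : ℂ) ≠ 0) (h : IsPentagon (split (op V)) (split (opStar V))) :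
    split (op V) * sliceRight (normTrace H) (split (op V)) ⊗ₜ 1 =
      sliceRight (normTrace H) (split (op V)) ⊗ₜ 1 := by
  rw [← split_map, ← split_mul, op_mul_sliceRight hn h]

theorem sliceRight_mul_split_op {V : H ⊗[ℂ] H ≃ₗᵢ[ℂ] H ⊗[ℂ] H}
    (hn : (Module.finrank ℂ H : ℂ) ≠ 0) (h : IsPentagon (split (op V)) (split (opStar V))) :
    sliceRight (normTrace H) (split (op V)) ⊗ₜ 1 * split (op V) =
      sliceRight (normTrace H) (split (op V)) ⊗ₜ 1 := by
  rw [← split_map, ← split_mul, sliceRight_mul_op hn h]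

theorem isIntegralPentagon {V : H ⊗[ℂ] H ≃ₗᵢ[ℂ] H ⊗[ℂ] H} (hV : IsMultiplicative V)
    (hmult : multiplicity V = 1) (hn : (Module.finrank ℂ H : ℂ) ≠ 0) :
    IsIntegralPentagon (split (op V)) (split (opStar V)) (normTrace H)
      (sliceRight (normTrace H) (split (op V))) (sliceLeft (normTrace H) (split (opStar V)))
      (Module.finrank ℂ H) := by
  have h := hV.isPentagon
  -- The properties of `s` are those of the fixed projection of the dual unitary. No multiplicity of
  -- the dual is needed here.
  have hd : IsPentagon (split (op (dualUnitary V))) (split (opStar (dualUnitary V))) := by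
    rw [split_op_dualUnitary, split_opStar_dualUnitary]
    exact h.flip
  have h1 := split_op_mul_sliceRight hn hd
  have h2 := sliceRight_mul_split_op hn hd
  have h3 := sliceRight_normTrace_symm hn hd
  rw [split_op_dualUnitary, sliceRight_comm] at h1 h2 h3
  rw [split_opStar_dualUnitary, sliceRight_comm] at h3
  have h4 := congrArg (TensorProduct.comm ℂ _ _) h1
  have h5 := congrArg (TensorProduct.comm ℂ _ _) h2
  simp only [comm_mul, TensorProduct.comm_tmul, TensorProduct.comm_comm] at h4 h5
  exact
    { toIsPentagon := h
      trace_comm := normTrace_comm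
      trace_one := normTrace_one hn
      sliceRight_left := rfl
      sliceRight_inv := sliceRight_normTrace_symm hn h
      sliceLeft_left := h3
      sliceLeft_inv := rfl
      mul_right := split_op_mul_sliceRight hn h
      mul_left := sliceRight_mul_split_op hn h
      mul_right' := by
        conv_lhs => rw [← h4]
        rw [← mul_assoc, h.mul_inv, one_mul]
      mul_left' := by
        conv_lhs => rw [← h5]
        rw [mul_assoc, h.inv_mul, mul_one]
      trace_integral := by
        rw [finrank_mul_normTrace hn, (isProj_fixedVectors hn h).trace]
        exact_mod_cast hmult }

theorem slice_mem_of_mem_tensorSpan {A B : Submodule ℂ (Module.End ℂ H)}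
    {T : Module.End ℂ (H ⊗[ℂ] H)} (hT : T ∈ tensorSpan A B)
    (φ : Module.Dual ℂ (Module.End ℂ H)) :
    sliceRight φ (split T) ∈ A ∧ sliceLeft φ (split T) ∈ B := by
  induction hT using Submodule.span_induction with
  | zero => simp
  | add x y _ _ hx hy =>
    simp only [map_add]
    exact ⟨add_mem hx.1 hy.1, add_mem hx.2 hy.2⟩
  | smul c x _ hx =>
    simp only [map_smul]
    exact ⟨A.smul_mem c hx.1, B.smul_mem c hx.2⟩
  | mem x hx =>
    obtain ⟨a, ha, b, hb, rfl⟩ := hx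
    rw [split_map, sliceRight_tmul, sliceLeft_tmul]
    exact ⟨A.smul_mem _ ha, B.smul_mem _ hb⟩

theorem S_eq_rightLeg (V : H ⊗[ℂ] H ≃ₗᵢ[ℂ] H ⊗[ℂ] H) : S V = rightLeg (split (op V)) :=
  SetLike.ext fun _ => Iff.rfl

theorem SHat_eq_rightLeg (V : H ⊗[ℂ] H ≃ₗᵢ[ℂ] H ⊗[ℂ] H) :
    SHat V = rightLeg (TensorProduct.comm ℂ _ _ (split (op V))) := by
  refine SetLike.ext fun x => exists_congr fun ω => ?_
  rw [sliceLeft_comm]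
  rfl

theorem split_delta (V : H ⊗[ℂ] H ≃ₗᵢ[ℂ] H ⊗[ℂ] H) (x : Module.End ℂ H) :
    split (delta V x) = coprod (split (op V)) (split (opStar V)) x := by
  rw [delta, split_mul, split_mul, split_map, coprod_apply]

theorem comm_split_deltaHat (V : H ⊗[ℂ] H ≃ₗᵢ[ℂ] H ⊗[ℂ] H) (x : Module.End ℂ H) :
    TensorProduct.comm ℂ _ _ (split (deltaHat V x)) =
      coprod (TensorProduct.comm ℂ _ _ (split (opStar V)))
        (TensorProduct.comm ℂ _ _ (split (op V))) x := by
  rw [deltaHat, split_mul, split_mul, split_map, coprod_apply, comm_mul, comm_mul,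
    TensorProduct.comm_tmul]

end MultUnitary

open MultUnitary TensorSlice

theorem mainTheorem12 {H : Type*} [NormedAddCommGroup H] [InnerProductSpace ℂ H]
    [FiniteDimensional ℂ H] (V : H ⊗[ℂ] H ≃ₗᵢ[ℂ] H ⊗[ℂ] H)
    (hV : MultUnitary.IsMultiplicative V) (hmult : MultUnitary.multiplicity V = 1) :
    (∀ B : Subalgebra ℂ (Module.End ℂ H),
      (MultUnitary.IsRightCoidealSubalgebra (MultUnitary.S V) (MultUnitary.delta V) B ∨
        MultUnitary.IsLeftCoidealSubalgebra (MultUnitary.S V) (MultUnitary.delta V) B) →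
      Module.finrank ℂ B ∣ Module.finrank ℂ (MultUnitary.S V)) ∧
    (∀ B : Subalgebra ℂ (Module.End ℂ H),
      (MultUnitary.IsRightCoidealSubalgebra (MultUnitary.SHat V) (MultUnitary.deltaHat V) B ∨
        MultUnitary.IsLeftCoidealSubalgebra (MultUnitary.SHat V) (MultUnitary.deltaHat V) B) →
      Module.finrank ℂ B ∣ Module.finrank ℂ (MultUnitary.S V)) := by
  -- A one-dimensional space of fixed vectors forces `H ≠ 0`.
  have hn : (Module.finrank ℂ H : ℂ) ≠ 0 := by
    intro h0
    have h1 : Module.finrank ℂ H = 0 := by exact_mod_cast h0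
    have h2 := Submodule.finrank_le (fixedVectors V)
    rw [h1] at h2
    change Module.finrank ℂ (fixedVectors V) = 1 at hmult
    omega
  have h := isIntegralPentagon hV hmult hn
  have hτ := eq_zero_of_normTrace_eq_zero hn
  have hnat := exists_natCast_eq_normTrace hn
  rw [S_eq_rightLeg, h.finrank_rightLeg hτ, SHat_eq_rightLeg, ← h.rightLeg_comm_inv]
  refine ⟨?_, ?_⟩
  · rintro B (⟨hB, hc⟩ | ⟨hB, hc⟩)
    · refine (h.isInvariantCoideal_right hτ (fun x hx => hB hx) fun x hx φ => ?_).finrank_dvd hnat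
      rw [← split_delta]
      exact (slice_mem_of_mem_tensorSpan (hc x hx) φ).1
    · refine (h.isInvariantCoideal_left hτ (fun x hx => hB hx) fun x hx φ => ?_).finrank_dvd hnat
      rw [← split_delta]
      exact (slice_mem_of_mem_tensorSpan (hc x hx) φ).2
  -- Passing to the dual solution flips the legs of `δ̂`, so right coideals of `Ŝ` become left ones
  -- and conversely.
  · rintro B (⟨hB, hc⟩ | ⟨hB, hc⟩)
    · refine (h.flip.isInvariantCoideal_left hτ (fun x hx => hB hx)
        fun x hx φ => ?_).finrank_dvd hnat
      rw [← comm_split_deltaHat, sliceLeft_comm]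
      exact (slice_mem_of_mem_tensorSpan (hc x hx) φ).1
    · refine (h.flip.isInvariantCoideal_right hτ (fun x hx => hB hx)
        fun x hx φ => ?_).finrank_dvd hnat
      rw [← comm_split_deltaHat, sliceRight_comm]
      exact (slice_mem_of_mem_tensorSpan (hc x hx) φ).2
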